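/- Let $J=\begin{pmatrix}0&0&0&-1\\0&1&0&0\\0&0&1&0\\-1&0&0&0\end{pmatrix}$ and let $O(3,1)=\{\Theta\in GL(4,\mathbb R):\Theta^TJ\Theta=J\}$. It acts on the 2-Möbius sphere (the projectivized light cone of $J$), in the local coordinate $m=(m_1,m_2)^T\in\mathbb R^2$, by $\Theta\cdot m=(u_1/u_3,\,u_2/u_3)^T$, where $(u_0,u_1,u_2,u_3)^T=\Theta\,(\tfrac12\|m\|^2,m_1,m_2,1)^T$, wherever $u_3\neq0$. For a parametrized curve $x\mapsto m(x)\in\mathbb R^2$ with $m'\neq0$ put $$\rho_M=\begin{pmatrix}1&0&0\\ \eta&I&0\\ \frac12\|\eta\|^2&\eta^T&1\end{pmatrix}\begin{pmatrix}\|m'\|^{-1}&0&0\\0&B&0\\0&0&\|m'\|\end{pmatrix}\begin{pmatrix}1&-m^T&\frac12\|m\|^2\\0&I&-m\\0&0&1\end{pmatrix},$$ $$B=\frac1{\|m'\|}\begin{pmatrix}m_1'&m_2'\\-m_2'&m_1'\end{pmatrix},\qquad \eta=\frac1{\|m'\|^2}\begin{pmatrix}m'\cdot m''\\-\det(m'\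 m'')\end{pmatrix}.$$ (1) If $m$ is $C^2$ near $x$, then $\rho_M(x)\in O(3,1)$ has determinant $1$, and $\rho_M$ is the conformal right moving frame normalized by $\rho_M\cdot m=0$, $\rho_M\cdot m'=(1,0)^T$, $\rho_M\cdot m''=0$ (prolonged action at $x$). If moreover $\Theta\in O(3,1)$, $\det\Theta=1$ and $u_3>0$ at $m(x)$, then the frame of $\Theta\cdot m$ at $x$ is $\rho_M(x)\,\Theta^{-1}$. (2) If $m$ is $C^3$ near $x$, then $\rho_M$ is differentiable at $x$ and $K_M=(\rho_M)_x\rho_M^{-1}$ is $$K_M=\begin{pmatrix}0&-1&0&0\\-\kappa_1&0&0&-1\\-\kappa_2&0&0&0\\0&-\kappa_1&-\kappa_2&0\end{pmatrix},$$ where $$\kappa_1=-\frac{m'\cdot m'''}{\|m'\|^2}+\frac32\frac{(m'\cdot m'')^2}{\|m'\|^4}-\frac32\frac{\det(m'\ m'')^2}{\|m'\|^4},\qquad \kappa_2=\frac{\det(m'\ m''')}{\|m'\|^2}-3\frac{(m'\cdot m'')\det(m'\ m'')}{\|m'\|^4}.$$ (3) For every $n\ge0$, if $m$ is $C^{n+3}$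 near $x$, $\Theta\in O(3,1)$ and $\Theta\cdot m(x)$ is defined, then $\Theta\cdot m$ is again regular at $x$ (its first derivative does not vanish), $\kappa_1^{(n)}$ takes the same value for $m$ and for $\Theta\cdot m$ at $x$, and $\kappa_2^{(n)}$ is multiplied by $\det\Theta=\pm1$. In particular $\kappa_1$, $\kappa_2$ and their derivatives are differential invariants of the orientation-preserving conformal group $SO(3,1)=\{\Theta\in O(3,1):\det\Theta=1\}$. (4) These invariants generate all others. Let $U$ be an open set of $k$-jets $(x,u,u',\dots,u^{(k)})$ of smooth curves in the coordinate plane, with $u'\ne0$ on $U$ (no condition if $k=0$). Let $I:U\to\mathbb R$ be invariant under the prolonged action of $SO(3,1)$, meaning that $I$ takes equal values at any two jets of $U$ that correspond under an element of $SO(3,1)$; the parameter $x$ is not acted on. Then the set $W$ of values of $(x,\kappa_1,\kappa_2,\kappa_1',\kappa_2',\dots,\kappa_1^{(k-3)},\kappa_2^{(k-3)})$ on $U$ is open, and there is a function $F$ with $$I=F\bigl(x,\kappa_1,\kappa_2,\kappa_1',\kappa_2',\dots,\kappa_1^{(k-3)},\kappa_2^{(k-3)}\bigr)\quad\text{on }U$$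 (only $x$ occurs if $k\le2$). For every $r\in\{0,1,2,\dots,\infty\}$, if $I$ is $C^r$ on $U$, then $F$ is $C^r$ on $W$. -/

import Mathlib

open scoped Matrix ContDiff

noncomputable section

namespace Moebius

/-- Coordinates `(m₁, m₂)` on the Möbius sphere; only dot products are used, never the sup norm. -/
abbrev Plane : Type := Fin 2 → ℝ

/-- The Lorentzian form on `ℝ⁴`. -/
def J : Matrix (Fin 4) (Fin 4) ℝ :=
  !![0, 0, 0, -1; 0, 1, 0, 0; 0, 0, 1, 0; -1, 0, 0, 0]

/-- `Θ` belongs to `O(3,1)`. -/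
def IsLorentz (Θ : Matrix (Fin 4) (Fin 4) ℝ) : Prop := Θᵀ * J * Θ = J

/-- The lift of the plane to the light cone. -/
def lift (p : Plane) : Fin 4 → ℝ := ![(p ⬝ᵥ p) / 2, p 0, p 1, 1]

/-- The projectivization, in the chart `u₃ ≠ 0`. -/
def proj (u : Fin 4 → ℝ) : Plane := ![u 1 / u 3, u 2 / u 3]

/-- The denominator of the conformal action of `Θ`: the point `p` is sent to a point of the chart
exactly when it does not vanish. -/
def denom (Θ : Matrix (Fin 4) (Fin 4) ℝ) (p : Plane) : ℝ := (Θ *ᵥ lift p) 3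

/-- The conformal action of `Θ` on the Möbius sphere, in the chart. -/
def act (Θ : Matrix (Fin 4) (Fin 4) ℝ) (p : Plane) : Plane := proj (Θ *ᵥ lift p)

/-- The Euclidean norm. -/
def norm2 (p : Plane) : ℝ := Real.sqrt (p ⬝ᵥ p)

/-- The determinant of the matrix with columns `p`, `q`. -/
def det2 (p q : Plane) : ℝ := p 0 * q 1 - p 1 * q 0

/-- The factor `g₁` of the local factorization `g = g₁ g₀ g₋₁`. -/
def gOne (η : Plane) : Matrix (Fin 4) (Fin 4) ℝ :=
  !![1, 0, 0, 0;
     η 0, 1, 0, 0;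
     η 1, 0, 1, 0;
     (η ⬝ᵥ η) / 2, η 0, η 1, 1]

/-- The factor `g₀`. -/
def gZero (β : ℝ) (B : Matrix (Fin 2) (Fin 2) ℝ) : Matrix (Fin 4) (Fin 4) ℝ :=
  !![β, 0, 0, 0;
     0, B 0 0, B 0 1, 0;
     0, B 1 0, B 1 1, 0;
     0, 0, 0, β⁻¹]

/-- The factor `g₋₁`. -/
def gMinusOne (w : Plane) : Matrix (Fin 4) (Fin 4) ℝ :=
  !![1, w 0, w 1, (w ⬝ᵥ w) / 2;
     0, 1, 0, w 0;
     0, 0, 1, w 1;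
     0, 0, 0, 1]

/-- The rotation part of the frame. -/
def frameB (m : ℝ → Plane) (x : ℝ) : Matrix (Fin 2) (Fin 2) ℝ :=
  (norm2 (deriv m x))⁻¹ • !![deriv m x 0, deriv m x 1; -deriv m x 1, deriv m x 0]

/-- The inversion part of the frame. -/
def frameEta (m : ℝ → Plane) (x : ℝ) : Plane :=
  ![(deriv m x ⬝ᵥ iteratedDeriv 2 m x) / norm2 (deriv m x) ^ 2,
    -det2 (deriv m x) (iteratedDeriv 2 m x) / norm2 (deriv m x) ^ 2]

/-- The conformal right moving frame along `m`. -/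
def rhoM (m : ℝ → Plane) (x : ℝ) : Matrix (Fin 4) (Fin 4) ℝ :=
  gOne (frameEta m x) * gZero (norm2 (deriv m x))⁻¹ (frameB m x) * gMinusOne (-m x)

/-- The right Maurer-Cartan matrix `(ρ_M)ₓ ρ_M⁻¹`; the derivative is entrywise. -/
def KM (m : ℝ → Plane) (x : ℝ) : Matrix (Fin 4) (Fin 4) ℝ :=
  (Matrix.of fun i j => deriv (fun t => rhoM m t i j) x) * (rhoM m x)⁻¹

/-- The form of the Lorentzian Maurer-Cartan matrix with entries `k₀, k₁, k₂`. -/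
def formKL (k₀ k₁ k₂ : ℝ) : Matrix (Fin 4) (Fin 4) ℝ :=
  !![0, -k₀, 0, 0;
     -k₁, 0, 0, -k₀;
     -k₂, 0, 0, 0;
     0, -k₁, -k₂, 0]

/-- The first conformal invariant. -/
def kappa1 (m : ℝ → Plane) (x : ℝ) : ℝ :=
  -((deriv m x ⬝ᵥ iteratedDeriv 3 m x) / norm2 (deriv m x) ^ 2
    - 3 / 2 * ((deriv m x ⬝ᵥ iteratedDeriv 2 m x) ^ 2 / norm2 (deriv m x) ^ 4)
    + 3 / 2 * (det2 (deriv m x) (iteratedDeriv 2 m x) ^ 2 / norm2 (deriv m x) ^ 4))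

/-- The second conformal invariant. -/
def kappa2 (m : ℝ → Plane) (x : ℝ) : ℝ :=
  det2 (deriv m x) (iteratedDeriv 3 m x) / norm2 (deriv m x) ^ 2
    - 3 * ((deriv m x ⬝ᵥ iteratedDeriv 2 m x) * det2 (deriv m x) (iteratedDeriv 2 m x)
        / norm2 (deriv m x) ^ 4)

/-- Fibre coordinates `(u, u', …, u⁽ᵏ⁾)` on the space of `k`-jets of curves. -/
abbrev JetFibre (k : ℕ) : Type := Fin (k + 1) → Plane

/-- The `k`-jet of a curve at `x`, without the coordinate `x`. -/
def jet (k : ℕ) (m : ℝ → Plane) (x : ℝ) : JetFibre k := fun i => iteratedDeriv (i : ℕ) m x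

/-- A jet is regular if its first derivative does not vanish (no condition when `k = 0`). -/
def JetFibre.IsRegular {k : ℕ} (u : JetFibre k) : Prop := ∀ i : Fin (k + 1), (i : ℕ) = 1 → u i ≠ 0

/-- `I`, a function on the set `U` of `k`-jets `(x, u, u', …, u⁽ᵏ⁾)`, is invariant under the
prolonged action of the orientation-preserving conformal group `SO(3,1)`: whenever `Θ` takes a jet
of `U` to a jet of `U`, the values of `I` agree. The parameter `x` is not acted on. -/
def IsDifferentialInvariantOn (k : ℕ) (U : Set (ℝ × JetFibre k)) (I : ℝ × JetFibre k → ℝ) :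
    Prop :=
  ∀ Θ : Matrix (Fin 4) (Fin 4) ℝ, IsLorentz Θ → Θ.det = 1 →
    ∀ (m : ℝ → Plane) (x : ℝ), ContDiffAt ℝ ∞ m x → denom Θ (m x) ≠ 0 →
      (x, jet k m x) ∈ U → (x, jet k (fun t => act Θ (m t)) x) ∈ U →
        I (x, jet k (fun t => act Θ (m t)) x) = I (x, jet k m x)

/-- The invariants `κ₁, κ₂` with their derivatives up to order `k - 3`, that is, those which are
functions of `k`-jets (none when `k ≤ 2`, where `k - 2` is `0`). -/
def kappaJet (k : ℕ) (m : ℝ → Plane) (x : ℝ) : Fin (k - 2) → Fin 2 → ℝ :=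
  fun j => ![iteratedDeriv (j : ℕ) (kappa1 m) x, iteratedDeriv (j : ℕ) (kappa2 m) x]

/-- The values taken by `(x, κ₁, κ₂, κ₁', κ₂', …)` on the jets in `U`. -/
def kappaImage (k : ℕ) (U : Set (ℝ × JetFibre k)) : Set (ℝ × (Fin (k - 2) → Fin 2 → ℝ)) :=
  {p | ∃ (m : ℝ → Plane) (x : ℝ), ContDiffAt ℝ ∞ m x ∧ (x, jet k m x) ∈ U ∧
    p = (x, kappaJet k m x)}

end Moebius

end

open Filter Topology

namespace Moebius

/-! ### Curves with first and second derivatives -/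

/-! The light cone linearizes the action: `lift (act Θ p)` is `Θ *ᵥ lift p` divided by `denom Θ p`
(`lift_act`). A 2-jet of a curve m becomes three vectors ℓ, ℓ', ℓ'' of ℝ⁴, where ℓ is the lift of m.
Dividing ℓ by a scalar function multiplies these vectors by a common factor and adds multiples of
the earlier ones. The frame puts this flag in standard position, and projecting back gives the
normalization. The frame of Θ·m and ρ_M Θ⁻¹ do this for the same flag, so they differ by a Lorentz
matrix of determinant 1 which preserves the standard flag with positive scale. Only the identity
does so (`IsLorentz.eq_one_of_flag`), which is equivariance (`rhoM_act`). The Maurer-Cartan matrix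
comes from the product rule on the three factors of the frame (`hasEntryDerivAt_rhoM`). Equivariance
holds on a neighbourhood and Θ⁻¹ is constant, so m and Θ·m have the same K_M, hence the same κ₁ and
κ₂. Negative denominators are handled by -Θ, determinant -1 by a reflection (`kappa_act`). For
generation, identify the plane with ℂ: -κ₁ + iκ₂ is the Schwarzian derivative of the curve
(`schwarzian_toComplex`). Its n-th derivative is z⁽ⁿ⁺³⁾/z' plus a function of lower derivatives, so
a 2-jet together with the derivatives of κ₁, κ₂ determines the whole jet. Two frames at x yield a
group element matching the 2-jets; if the curvatures agree it matches the k-jets (`jet_transport`),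
so an invariant I factors through the curvatures. Conversely, the same triangular structure yields a
smooth family of curves with arbitrary curvature data, and a fixed group element moves it through
any given jet (`exists_section`). Composing I with this local section shows that F is as smooth as
I, and the section also shows that W is open. -/

/-- `f` is differentiable near `x`, with first and second derivatives `b`, `c` at `x`. -/
def HasJet2 {E : Type*} [NormedAddCommGroup E] [NormedSpace ℝ E] (f : ℝ → E) (x : ℝ) (b c : E) :
    Prop :=
  ∃ f' : ℝ → E, (∀ᶠ t in 𝓝 x, HasDerivAt f (f' t) t) ∧ f' x = b ∧ HasDerivAt f' c x

section HasJet2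

variable {E F : Type*} [NormedAddCommGroup E] [NormedSpace ℝ E] [NormedAddCommGroup F]
  [NormedSpace ℝ F] {f : ℝ → E} {x : ℝ} {b c : E}

lemma HasJet2.hasDerivAt (h : HasJet2 f x b c) : HasDerivAt f b x := by
  obtain ⟨f', h1, rfl, -⟩ := h
  exact h1.self_of_nhds

lemma HasJet2.deriv_eq (h : HasJet2 f x b c) : deriv f x = b := h.hasDerivAt.deriv

lemma HasJet2.iteratedDeriv_two_eq (h : HasJet2 f x b c) : iteratedDeriv 2 f x = c := by
  obtain ⟨f', h1, rfl, h2⟩ := h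
  rw [iteratedDeriv_succ, iteratedDeriv_one]
  have : deriv f =ᶠ[𝓝 x] f' := h1.mono fun t ht => ht.deriv
  rw [this.deriv_eq, h2.deriv]

lemma HasJet2.congr {g : ℝ → E} (h : HasJet2 f x b c) (hg : g =ᶠ[𝓝 x] f) : HasJet2 g x b c := by
  obtain ⟨f', h1, h2, h3⟩ := h
  refine ⟨f', ?_, h2, h3⟩
  filter_upwards [h1, hg.eventuallyEq_nhds] with t ht htg using ht.congr_of_eventuallyEq htg

lemma contDiffAt_deriv {n : WithTop ℕ∞} (h : ContDiffAt ℝ (n + 1) f x) :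
    ContDiffAt ℝ n (deriv f) x :=
  (h.fderiv_right le_rfl).clm_apply contDiffAt_const

lemma _root_.ContDiffAt.hasJet2 (h : ContDiffAt ℝ 2 f x) :
    HasJet2 f x (deriv f x) (iteratedDeriv 2 f x) := by
  refine ⟨deriv f, ?_, rfl, ?_⟩
  · filter_upwards [h.eventually (by simp)] with t ht
    exact (ht.differentiableAt (by norm_num)).hasDerivAt
  · rw [iteratedDeriv_succ, iteratedDeriv_one]
    exact ((contDiffAt_deriv (n := 1) h).differentiableAt (by norm_num)).hasDerivAt

lemma HasJet2.mul {f g : ℝ → ℝ} {b c b' c' : ℝ} (hf : HasJet2 f x b c) (hg : HasJet2 g x b' c') :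
    HasJet2 (fun t => f t * g t) x (b * g x + f x * b') (c * g x + 2 * (b * b') + f x * c') := by
  have hf0 := hf.hasDerivAt
  have hg0 := hg.hasDerivAt
  obtain ⟨f', f1, rfl, f2⟩ := hf
  obtain ⟨g', g1, rfl, g2⟩ := hg
  refine ⟨fun t => f' t * g t + f t * g' t, ?_, rfl, ?_⟩
  · filter_upwards [f1, g1] with t h1 h2 using h1.mul h2
  · exact ((f2.mul hg0).add (hf0.mul g2)).congr_deriv (by ring)

lemma HasJet2.clm (h : HasJet2 f x b c) (L : E →L[ℝ] F) :
    HasJet2 (fun t => L (f t)) x (L b) (L c) := by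
  obtain ⟨f', h1, rfl, h2⟩ := h
  refine ⟨fun t => L (f' t), ?_, rfl, ?_⟩
  · filter_upwards [h1] with t ht using L.hasFDerivAt.comp_hasDerivAt t ht
  · exact L.hasFDerivAt.comp_hasDerivAt x h2

lemma HasJet2.add {g : ℝ → E} {b' c' : E} (h : HasJet2 f x b c) (hg : HasJet2 g x b' c') :
    HasJet2 (fun t => f t + g t) x (b + b') (c + c') := by
  obtain ⟨f', h1, rfl, h2⟩ := h
  obtain ⟨g', g1, rfl, g2⟩ := hg
  refine ⟨fun t => f' t + g' t, ?_, rfl, h2.add g2⟩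
  filter_upwards [h1, g1] with t ht hg using ht.add hg

lemma hasJet2_const (a : E) : HasJet2 (fun _ => a) x 0 0 :=
  ⟨fun _ => 0, Eventually.of_forall fun t => hasDerivAt_const t a, rfl, hasDerivAt_const x 0⟩

lemma hasJet2_pi {n : ℕ} {f : ℝ → Fin n → ℝ} {b c : Fin n → ℝ}
    (h : ∀ i, HasJet2 (fun t => f t i) x (b i) (c i)) : HasJet2 f x b c := by
  choose f' h1 h2 h3 using h
  refine ⟨fun t i => f' i t, ?_, funext h2, hasDerivAt_pi.2 h3⟩
  filter_upwards [eventually_all.2 h1] with t ht using hasDerivAt_pi.2 ht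

lemma HasJet2.apply {n : ℕ} {f : ℝ → Fin n → ℝ} {b c : Fin n → ℝ}
    (h : HasJet2 f x b c) (i : Fin n) : HasJet2 (fun t => f t i) x (b i) (c i) :=
  h.clm (ContinuousLinearMap.proj (R := ℝ) (φ := fun _ : Fin n => ℝ) i)

end HasJet2

/-! ### The Lorentz group -/

lemma det_J : J.det = -1 := by
  simp [J, Matrix.det_succ_row_zero, Fin.sum_univ_succ, Fin.succAbove]
  norm_num

lemma IsLorentz.mul {A B : Matrix (Fin 4) (Fin 4) ℝ} (hA : IsLorentz A) (hB : IsLorentz B) :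
    IsLorentz (A * B) := by
  unfold IsLorentz at *
  calc (A * B)ᵀ * J * (A * B) = Bᵀ * (Aᵀ * J * A) * B := by
        rw [Matrix.transpose_mul]; simp only [Matrix.mul_assoc]
    _ = J := by rw [hA, hB]

lemma IsLorentz.neg {A : Matrix (Fin 4) (Fin 4) ℝ} (hA : IsLorentz A) : IsLorentz (-A) := by
  unfold IsLorentz at *
  simpa using hA

lemma IsLorentz.det_sq {A : Matrix (Fin 4) (Fin 4) ℝ} (hA : IsLorentz A) : A.det * A.det = 1 := by
  have h := congrArg Matrix.det hA
  rw [Matrix.det_mul, Matrix.det_mul, Matrix.det_transpose, det_J] at h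
  linarith

lemma IsLorentz.isUnit_det {A : Matrix (Fin 4) (Fin 4) ℝ} (hA : IsLorentz A) : IsUnit A.det :=
  .of_mul_eq_one _ hA.det_sq

lemma IsLorentz.inv {A : Matrix (Fin 4) (Fin 4) ℝ} (hA : IsLorentz A) : IsLorentz A⁻¹ := by
  have hu := hA.isUnit_det
  unfold IsLorentz at *
  calc A⁻¹ᵀ * J * A⁻¹ = A⁻¹ᵀ * (Aᵀ * J * A) * A⁻¹ := by rw [hA]
    _ = (A * A⁻¹)ᵀ * J * (A * A⁻¹) := by
        rw [Matrix.transpose_mul]; simp only [Matrix.mul_assoc]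
    _ = J := by rw [Matrix.mul_nonsing_inv _ hu]; simp

lemma det_inv_eq_one {A : Matrix (Fin 4) (Fin 4) ℝ} (hA : A.det = 1) : A⁻¹.det = 1 := by
  rw [Matrix.det_nonsing_inv, hA, Ring.inverse_one]

/-- The Lorentzian inner product. -/
def lor (u v : Fin 4 → ℝ) : ℝ := -(u 0 * v 3) + u 1 * v 1 + u 2 * v 2 - u 3 * v 0

lemma lor_eq (u v : Fin 4 → ℝ) : lor u v = u ⬝ᵥ (J *ᵥ v) := by
  simp [lor, J, Matrix.mulVec, dotProduct, Fin.sum_univ_four]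
  ring

lemma IsLorentz.lor_mulVec {A : Matrix (Fin 4) (Fin 4) ℝ} (hA : IsLorentz A) (u v : Fin 4 → ℝ) :
    lor (A *ᵥ u) (A *ᵥ v) = lor u v := by
  unfold IsLorentz at hA
  rw [lor_eq, lor_eq]
  conv_rhs => rw [← hA]
  rw [Matrix.mulVec_mulVec, ← Matrix.vecMul_transpose, ← Matrix.dotProduct_mulVec,
    Matrix.mulVec_mulVec, Matrix.mul_assoc]

lemma lor_lift (p : Plane) : lor (lift p) (lift p) = 0 := by
  simp [lor, lift, dotProduct, Fin.sum_univ_two]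
  ring

/-- On the light cone u₁² + u₂² = 2u₀u₃, so u₀ is determined by the other coordinates once u₃ ≠ 0.
-/
lemma lift_proj {u : Fin 4 → ℝ} (hu : lor u u = 0) (h3 : u 3 ≠ 0) :
    lift (proj u) = (u 3)⁻¹ • u := by
  have h0 : u 1 * u 1 + u 2 * u 2 = 2 * u 0 * u 3 := by
    unfold lor at hu; linarith
  ext i
  fin_cases i
  · simp [lift, proj, dotProduct, Fin.sum_univ_two]
    field_simp
    linarith
  · simp [lift, proj]; field_simp
  · simp [lift, proj]; field_simp
  · simp [lift]; field_simp

lemma lift_act {Θ : Matrix (Fin 4) (Fin 4) ℝ} (hΘ : IsLorentz Θ) {p : Plane}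
    (h : denom Θ p ≠ 0) : lift (act Θ p) = (denom Θ p)⁻¹ • (Θ *ᵥ lift p) :=
  lift_proj (by rw [hΘ.lor_mulVec, lor_lift]) h

/-- A Lorentz matrix of determinant `1` which fixes the flag of the normalized 2-jet is `1`. -/
lemma IsLorentz.eq_one_of_flag {H : Matrix (Fin 4) (Fin 4) ℝ} (hH : IsLorentz H) (hd : H.det = 1)
    {c a b : ℝ} (hc : 0 < c) (h3 : H *ᵥ ![0, 0, 0, 1] = ![0, 0, 0, c])
    (h1 : H *ᵥ ![0, 1, 0, 0] = ![0, c, 0, c * a])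
    (h0 : H *ᵥ ![1, 0, 0, 0] = ![c, 2 * c * a, 0, b]) : H = 1 := by
  have l11 := hH.lor_mulVec ![0, 1, 0, 0] ![0, 1, 0, 0]
  have l01 := hH.lor_mulVec ![1, 0, 0, 0] ![0, 1, 0, 0]
  have l00 := hH.lor_mulVec ![1, 0, 0, 0] ![1, 0, 0, 0]
  have l20 := hH.lor_mulVec ![0, 0, 1, 0] ![1, 0, 0, 0]
  have l21 := hH.lor_mulVec ![0, 0, 1, 0] ![0, 1, 0, 0]
  have l23 := hH.lor_mulVec ![0, 0, 1, 0] ![0, 0, 0, 1]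
  have e : H *ᵥ ![0, 0, 1, 0] = fun i => H i 2 := by
    ext i; simp [Matrix.mulVec, dotProduct, Fin.sum_univ_four]
  rw [h1] at l11 l01 l21
  rw [h0] at l01 l00 l20
  rw [h3] at l23
  rw [e] at l20 l21 l23
  simp [lor] at l11 l01 l00 l20 l21 l23
  -- Preservation of ⟨e₁, e₁⟩ gives c² = 1, and positivity selects c = 1. Then ⟨e₀, e₁⟩ gives a = 0
  -- and ⟨e₀, e₀⟩ gives b = 0.
  have hc1 : c = 1 := by nlinarith
  subst hc1
  have ha : a = 0 := by linarith
  subst ha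
  have hb : b = 0 := by linarith
  subst hb
  simp at l20 l21 l23
  have c0 : ∀ i, H i 0 = ![(1 : ℝ), 0, 0, 0] i := fun i => by
    have := congrFun h0 i
    simpa [Matrix.mulVec, dotProduct, Fin.sum_univ_four] using this
  have c1 : ∀ i, H i 1 = ![(0 : ℝ), 1, 0, 0] i := fun i => by
    have := congrFun h1 i
    simpa [Matrix.mulVec, dotProduct, Fin.sum_univ_four] using this
  have c3 : ∀ i, H i 3 = ![(0 : ℝ), 0, 0, 1] i := fun i => by
    have := congrFun h3 i
    simpa [Matrix.mulVec, dotProduct, Fin.sum_univ_four] using this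
  -- Orthogonality of the image of e₂ to e₀, e₁, e₃ leaves only the entry `H 2 2`, which the
  -- determinant fixes.
  have hH' : H = !![1, 0, 0, 0; 0, 1, 0, 0; 0, 0, H 2 2, 0; 0, 0, 0, 1] := by
    ext i j
    fin_cases j
    · fin_cases i <;> simp [c0]
    · fin_cases i <;> simp [c1]
    · fin_cases i <;> simp [l20, l21, l23]
    · fin_cases i <;> simp [c3]
  have hdet : H.det = H 2 2 := by
    conv_lhs => rw [hH']
    simp [Matrix.det_succ_row_zero, Fin.sum_univ_succ, Fin.succAbove]
  rw [hH', ← hdet, hd]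
  ext i j
  fin_cases i <;> fin_cases j <;> simp

/-! ### Derivatives of lifted curves -/

lemma lift_apply_zero (p : Plane) : lift p 0 = (p 0 * p 0 + p 1 * p 1) / 2 := by
  simp [lift, dotProduct, Fin.sum_univ_two]

lemma HasJet2.lift {m : ℝ → Plane} {x : ℝ} {b c : Plane} (h : HasJet2 m x b c) :
    HasJet2 (fun t => Moebius.lift (m t)) x ![m x ⬝ᵥ b, b 0, b 1, 0]
      ![b ⬝ᵥ b + m x ⬝ᵥ c, c 0, c 1, 0] := by
  refine hasJet2_pi fun i => ?_
  have h0 := h.apply 0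
  have h1 := h.apply 1
  fin_cases i
  · have := (((h0.mul h0).add (h1.mul h1)).mul (hasJet2_const (x := x) (1 / 2 : ℝ)))
    convert this using 1
    · ext t; simp [lift_apply_zero]; ring
    · simp [dotProduct, Fin.sum_univ_two]; ring
    · simp [dotProduct, Fin.sum_univ_two]; ring
  · exact h0
  · exact h1
  · exact hasJet2_const (x := x) (1 : ℝ)

lemma HasJet2.mulVec {u : ℝ → Fin 4 → ℝ} {x : ℝ} {b c : Fin 4 → ℝ} (h : HasJet2 u x b c)
    (A : Matrix (Fin 4) (Fin 4) ℝ) : HasJet2 (fun t => A *ᵥ u t) x (A *ᵥ b) (A *ᵥ c) :=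
  h.clm (LinearMap.toContinuousLinearMap (Matrix.mulVecLin A))

lemma HasJet2.smul_vec {u : ℝ → Fin 4 → ℝ} {d : ℝ → ℝ} {x b c : ℝ} {b' c' : Fin 4 → ℝ}
    (hd : HasJet2 d x b c) (h : HasJet2 u x b' c') :
    HasJet2 (fun t => d t • u t) x (b • u x + d x • b') (c • u x + (2 * b) • b' + d x • c') := by
  refine hasJet2_pi fun i => ?_
  have e : (c • u x + (2 * b) • b' + d x • c') i
      = c * u x i + 2 * (b * b' i) + d x * c' i := by
    simp; ring
  rw [e]
  exact hd.mul (h.apply i)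

lemma contDiff_lift {n : WithTop ℕ∞} : ContDiff ℝ n lift := by
  refine contDiff_pi.2 fun i => ?_
  fin_cases i
  · simp only [lift_apply_zero, Fin.zero_eta]; fun_prop
  · simp only [lift]; simp; fun_prop
  · simp only [lift]; simp; fun_prop
  · simp only [lift]; simp; fun_prop

lemma contDiff_mulVec_lift {n : WithTop ℕ∞} (A : Matrix (Fin 4) (Fin 4) ℝ) (i : Fin 4) :
    ContDiff ℝ n (fun p => (A *ᵥ lift p) i) :=
  contDiff_pi.1 ((LinearMap.toContinuousLinearMap (Matrix.mulVecLin A)).contDiff.comp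
    contDiff_lift) i

lemma contDiffAt_act {n : WithTop ℕ∞} {A : Matrix (Fin 4) (Fin 4) ℝ} {p : Plane}
    (h : denom A p ≠ 0) : ContDiffAt ℝ n (act A) p := by
  refine contDiffAt_pi.2 fun i => ?_
  fin_cases i
  · exact (contDiff_mulVec_lift A 1).contDiffAt.div (contDiff_mulVec_lift A 3).contDiffAt h
  · exact (contDiff_mulVec_lift A 2).contDiffAt.div (contDiff_mulVec_lift A 3).contDiffAt h

lemma contDiffAt_act_comp {n : WithTop ℕ∞} {A : Matrix (Fin 4) (Fin 4) ℝ} {m : ℝ → Plane} {x : ℝ}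
    (hm : ContDiffAt ℝ n m x) (h : denom A (m x) ≠ 0) :
    ContDiffAt ℝ n (fun t => act A (m t)) x :=
  (contDiffAt_act h).comp x hm

lemma eventually_denom_ne_zero {A : Matrix (Fin 4) (Fin 4) ℝ} {m : ℝ → Plane} {x : ℝ}
    (hm : ContinuousAt m x) (h : denom A (m x) ≠ 0) : ∀ᶠ t in 𝓝 x, denom A (m t) ≠ 0 :=
  ((contDiff_mulVec_lift (n := 0) A 3).continuous.continuousAt.comp hm).eventually_ne h

/-! ### The frame on lifted 2-jets -/

lemma dot_self (p : Plane) : p ⬝ᵥ p = p 0 * p 0 + p 1 * p 1 := by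
  simp [dotProduct, Fin.sum_univ_two]

lemma dot_eq (p q : Plane) : p ⬝ᵥ q = p 0 * q 0 + p 1 * q 1 := by
  simp [dotProduct, Fin.sum_univ_two]

lemma norm2_sq (p : Plane) : norm2 p ^ 2 = p ⬝ᵥ p := by
  rw [norm2, Real.sq_sqrt]
  rw [dot_self]; nlinarith [mul_self_nonneg (p 0), mul_self_nonneg (p 1)]

lemma norm2_pos {p : Plane} (hp : p ≠ 0) : 0 < norm2 p := by
  refine Real.sqrt_pos.2 ?_
  rw [dot_self]
  by_contra h
  have h0 : p 0 = 0 := by nlinarith [mul_self_nonneg (p 0), mul_self_nonneg (p 1)]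
  have h1 : p 1 = 0 := by nlinarith [mul_self_nonneg (p 0), mul_self_nonneg (p 1)]
  exact hp (funext fun i => by fin_cases i <;> simp [h0, h1])

lemma gMinusOne_mulVec (w : Plane) (u : Fin 4 → ℝ) : gMinusOne w *ᵥ u =
    ![u 0 + w 0 * u 1 + w 1 * u 2 + (w ⬝ᵥ w) / 2 * u 3, u 1 + w 0 * u 3, u 2 + w 1 * u 3, u 3] := by
  ext i
  fin_cases i <;> simp [gMinusOne, Matrix.mulVec, dotProduct, Fin.sum_univ_four]

lemma gZero_mulVec (β : ℝ) (B : Matrix (Fin 2) (Fin 2) ℝ) (u : Fin 4 → ℝ) : gZero β B *ᵥ u =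
    ![β * u 0, B 0 0 * u 1 + B 0 1 * u 2, B 1 0 * u 1 + B 1 1 * u 2, β⁻¹ * u 3] := by
  ext i
  fin_cases i <;> simp [gZero, Matrix.mulVec, dotProduct, Fin.sum_univ_four]

lemma gOne_mulVec (η : Plane) (u : Fin 4 → ℝ) : gOne η *ᵥ u =
    ![u 0, η 0 * u 0 + u 1, η 1 * u 0 + u 2, (η ⬝ᵥ η) / 2 * u 0 + η 0 * u 1 + η 1 * u 2 + u 3] := by
  ext i
  fin_cases i <;> simp [gOne, Matrix.mulVec, dotProduct, Fin.sum_univ_four]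

lemma isLorentz_gMinusOne (w : Plane) : IsLorentz (gMinusOne w) := by
  ext i j
  fin_cases i <;> fin_cases j <;>
    simp [gMinusOne, J, Matrix.mul_apply, Fin.sum_univ_four]
  ring

lemma isLorentz_gOne (w : Plane) : IsLorentz (gOne w) := by
  ext i j
  fin_cases i <;> fin_cases j <;>
    simp [gOne, J, Matrix.mul_apply, Fin.sum_univ_four]
  ring

lemma isLorentz_gZero {β c s : ℝ} (hβ : β ≠ 0) (h : c * c + s * s = 1) :
    IsLorentz (gZero β !![c, s; -s, c]) := by
  ext i j
  fin_cases i <;> fin_cases j <;>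
    simp [gZero, J, Matrix.mul_apply, Fin.sum_univ_four, hβ] <;> linarith

lemma det_gMinusOne (w : Plane) : (gMinusOne w).det = 1 := by
  simp [gMinusOne, Matrix.det_succ_row_zero, Fin.sum_univ_succ, Fin.succAbove]

lemma det_gOne (w : Plane) : (gOne w).det = 1 := by
  simp [gOne, Matrix.det_succ_row_zero, Fin.sum_univ_succ, Fin.succAbove]

lemma det_gZero {β c s : ℝ} (hβ : β ≠ 0) (h : c * c + s * s = 1) :
    (gZero β !![c, s; -s, c]).det = 1 := by
  simp [gZero, Matrix.det_succ_row_zero, Fin.sum_univ_succ, Fin.succAbove]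
  field_simp
  linarith

/-- Shows the rotation in the shape `!![c, s; -s, c]` used by the lemmas on `gZero`. -/
lemma frameB_eq (m : ℝ → Plane) (x : ℝ) : frameB m x =
    !![deriv m x 0 / norm2 (deriv m x), deriv m x 1 / norm2 (deriv m x);
      -(deriv m x 1 / norm2 (deriv m x)), deriv m x 0 / norm2 (deriv m x)] := by
  ext i j
  fin_cases i <;> fin_cases j <;> simp [frameB] <;> ring

section Frame

variable {m : ℝ → Plane} {x : ℝ}

lemma frameB_unit (h : deriv m x ≠ 0) :
    deriv m x 0 / norm2 (deriv m x) * (deriv m x 0 / norm2 (deriv m x)) +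
      deriv m x 1 / norm2 (deriv m x) * (deriv m x 1 / norm2 (deriv m x)) = 1 := by
  have h1 := norm2_pos h
  have h2 := norm2_sq (deriv m x)
  rw [dot_self] at h2
  field_simp
  linarith

lemma isLorentz_rhoM (h : deriv m x ≠ 0) : IsLorentz (rhoM m x) := by
  rw [rhoM, frameB_eq]
  exact ((isLorentz_gOne _).mul (isLorentz_gZero (inv_ne_zero (norm2_pos h).ne')
    (frameB_unit h))).mul (isLorentz_gMinusOne _)

lemma det_rhoM (h : deriv m x ≠ 0) : (rhoM m x).det = 1 := by
  rw [rhoM, frameB_eq, Matrix.det_mul, Matrix.det_mul, det_gOne, det_gMinusOne,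
    det_gZero (inv_ne_zero (norm2_pos h).ne') (frameB_unit h)]
  norm_num

/-- `gMinusOne` translates the point to the origin, whose lift e₃ is scaled by `gZero` and fixed by
`gOne`. -/
lemma rhoM_mulVec_lift : rhoM m x *ᵥ lift (m x) = ![0, 0, 0, norm2 (deriv m x)] := by
  rw [rhoM, ← Matrix.mulVec_mulVec, ← Matrix.mulVec_mulVec, gMinusOne_mulVec, gZero_mulVec,
    gOne_mulVec]
  have e : lift (m x) 0 + (-m x) 0 * lift (m x) 1 + (-m x) 1 * lift (m x) 2 +
      -m x ⬝ᵥ -m x / 2 * lift (m x) 3 = 0 := by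
    simp [lift]; ring
  rw [e]
  ext i
  fin_cases i <;> simp [lift]

/-- The rotation turns m' to the positive first axis; `gOne` only adds a multiple of e₃. -/
lemma rhoM_mulVec_deriv (h : deriv m x ≠ 0) :
    rhoM m x *ᵥ ![m x ⬝ᵥ deriv m x, deriv m x 0, deriv m x 1, 0] =
      ![0, norm2 (deriv m x), 0, norm2 (deriv m x) * frameEta m x 0] := by
  have h1 := norm2_pos h
  have h2 := norm2_sq (deriv m x)
  rw [dot_self] at h2
  rw [rhoM, ← Matrix.mulVec_mulVec, ← Matrix.mulVec_mulVec, gMinusOne_mulVec, gZero_mulVec,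
    gOne_mulVec, frameB_eq]
  generalize frameEta m x = η
  ext i
  fin_cases i
  · simp
  · simp; field_simp; linarith
  · simp; field_simp; ring
  · simp; field_simp
    linear_combination -η 0 * h2

/-- The second component of η is chosen to produce the 0. The first produces the factor 2, which the
product rule cancels after projection. The last entry is irrelevant, being multiplied by a vanishing
position. -/
lemma rhoM_mulVec_deriv_two (h : deriv m x ≠ 0) : ∃ c,
    rhoM m x *ᵥ ![deriv m x ⬝ᵥ deriv m x + m x ⬝ᵥ iteratedDeriv 2 m x, iteratedDeriv 2 m x 0,
      iteratedDeriv 2 m x 1, 0] =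
      ![norm2 (deriv m x), 2 * norm2 (deriv m x) * frameEta m x 0, 0, c] := by
  have h1 := norm2_pos h
  have h2 := norm2_sq (deriv m x)
  set v : Fin 4 → ℝ := ![deriv m x ⬝ᵥ deriv m x + m x ⬝ᵥ iteratedDeriv 2 m x,
    iteratedDeriv 2 m x 0, iteratedDeriv 2 m x 1, 0] with hv
  have e : ∃ c, rhoM m x *ᵥ v = ![(norm2 (deriv m x))⁻¹ * norm2 (deriv m x) ^ 2,
      frameEta m x 0 * ((norm2 (deriv m x))⁻¹ * norm2 (deriv m x) ^ 2) +
        (deriv m x ⬝ᵥ iteratedDeriv 2 m x) / norm2 (deriv m x),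
      frameEta m x 1 * ((norm2 (deriv m x))⁻¹ * norm2 (deriv m x) ^ 2) +
        det2 (deriv m x) (iteratedDeriv 2 m x) / norm2 (deriv m x), c] := by
    refine ⟨(rhoM m x *ᵥ v) 3, ?_⟩
    nth_rw 1 [rhoM]
    rw [← Matrix.mulVec_mulVec, ← Matrix.mulVec_mulVec, gMinusOne_mulVec, gZero_mulVec]
    have e0 : v 0 + (-m x) 0 * v 1 + (-m x) 1 * v 2 + -m x ⬝ᵥ -m x / 2 * v 3
        = norm2 (deriv m x) ^ 2 := by
      rw [h2]; simp [hv]; ring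
    rw [e0]
    ext i
    fin_cases i
    · simp [gOne_mulVec]
    · simp [gOne_mulVec, frameB_eq, hv]; ring
    · simp [gOne_mulVec, frameB_eq, hv, det2]; ring
    · rw [rhoM, ← Matrix.mulVec_mulVec, ← Matrix.mulVec_mulVec, gMinusOne_mulVec, gZero_mulVec, e0]
      rfl
  obtain ⟨c, hc⟩ := e
  refine ⟨c, ?_⟩
  rw [hc]
  simp only [frameEta]
  ext i
  fin_cases i
  · simp; field_simp
  · simp; field_simp; ring
  · simp; field_simp; ring
  · simp

/-- The frame normalizes the curve. -/
lemma hasJet2_act_rhoM (hm : ContDiffAt ℝ 2 m x) (h : deriv m x ≠ 0) :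
    act (rhoM m x) (m x) = 0 ∧ HasJet2 (fun t => act (rhoM m x) (m t)) x ![1, 0] 0 := by
  have h1 := norm2_pos h
  have h0 := rhoM_mulVec_lift (m := m) (x := x)
  have hd : denom (rhoM m x) (m x) = norm2 (deriv m x) := by simp [denom, h0]
  refine ⟨?_, ?_⟩
  · rw [act, h0]; ext i; fin_cases i <;> simp [proj]
  have hu := (hm.hasJet2.lift).mulVec (rhoM m x)
  rw [rhoM_mulVec_deriv h] at hu
  obtain ⟨c, hc⟩ := rhoM_mulVec_deriv_two (x := x) (m := m) h
  rw [hc] at hu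
  have hv := (contDiffAt_act_comp (A := rhoM m x) hm (by rw [hd]; exact h1.ne')).hasJet2
  -- With v the projected curve and u its lift, vᵢu₃ = uᵢ near x. The product rule for this
  -- identity, at a point where v = 0, avoids differentiating a quotient.
  have key : ∀ i : Fin 2, HasJet2 (fun t => (rhoM m x *ᵥ lift (m t)) (![1, 2] i)) x
      (deriv (fun t => act (rhoM m x) (m t)) x i * norm2 (deriv m x))
      (iteratedDeriv 2 (fun t => act (rhoM m x) (m t)) x i * norm2 (deriv m x)
        + 2 * (deriv (fun t => act (rhoM m x) (m t)) x i * (norm2 (deriv m x) * frameEta m x 0))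
        ) := by
    intro i
    have := (hv.apply i).mul (hu.apply 3)
    have e0 : act (rhoM m x) (m x) i = 0 := by
      rw [act, h0]; fin_cases i <;> simp [proj]
    simp only [e0, h0] at this
    simp at this
    refine this.congr ?_
    filter_upwards [eventually_denom_ne_zero (A := rhoM m x) hm.continuousAt
      (by rw [hd]; exact h1.ne')] with t ht
    unfold denom at ht
    fin_cases i <;> simp [act, proj] <;> field_simp
  have k0 := (key 0).deriv_eq.symm.trans (hu.apply 1).deriv_eq
  have k1 := (key 1).deriv_eq.symm.trans (hu.apply 2).deriv_eq
  have q0 := (key 0).iteratedDeriv_two_eq.symm.trans (hu.apply 1).iteratedDeriv_two_eq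
  have q1 := (key 1).iteratedDeriv_two_eq.symm.trans (hu.apply 2).iteratedDeriv_two_eq
  simp at k0 k1
  have d0 : deriv (fun t => act (rhoM m x) (m t)) x 0 = 1 := by
    simpa [h1.ne'] using k0
  have d1 : deriv (fun t => act (rhoM m x) (m t)) x 1 = 0 := by
    simpa [h1.ne'] using k1
  rw [d0] at q0
  rw [d1] at q1
  simp at q0 q1
  have dd0 : iteratedDeriv 2 (fun t => act (rhoM m x) (m t)) x 0 = 0 := by
    have : iteratedDeriv 2 (fun t => act (rhoM m x) (m t)) x 0 * norm2 (deriv m x) = 0 := by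
      linarith
    simpa [h1.ne'] using this
  have dd1 : iteratedDeriv 2 (fun t => act (rhoM m x) (m t)) x 1 = 0 := by
    simpa [h1.ne'] using q1
  convert hv using 1
  · ext i; fin_cases i <;> simp [d0, d1]
  · ext i; fin_cases i <;> simp [dd0, dd1]

end Frame

/-! ### Equivariance of the frame -/

section Equivariance

variable {m : ℝ → Plane} {x : ℝ} {Θ : Matrix (Fin 4) (Fin 4) ℝ}

/-- The 2-jet of the lift of the transformed curve. -/
lemma hasJet2_lift_act (hm : ContDiffAt ℝ 2 m x) (hΘ : IsLorentz Θ) (hd : denom Θ (m x) ≠ 0) :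
    ∃ a b : ℝ, HasJet2 (fun t => lift (act Θ (m t))) x
      (a • (Θ *ᵥ lift (m x)) + (denom Θ (m x))⁻¹ • (Θ *ᵥ ![m x ⬝ᵥ deriv m x, deriv m x 0, deriv m x 1, 0]))
      (b • (Θ *ᵥ lift (m x)) + (2 * a) • (Θ *ᵥ ![m x ⬝ᵥ deriv m x, deriv m x 0, deriv m x 1, 0])
        + (denom Θ (m x))⁻¹ • (Θ *ᵥ ![deriv m x ⬝ᵥ deriv m x + m x ⬝ᵥ iteratedDeriv 2 m x,
          iteratedDeriv 2 m x 0, iteratedDeriv 2 m x 1, 0])) := by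
  have hc : ContDiffAt ℝ 2 (fun t => (denom Θ (m t))⁻¹) x :=
    ((contDiff_mulVec_lift Θ 3).contDiffAt.comp x hm).inv hd
  refine ⟨_, _, (hc.hasJet2.smul_vec (hm.hasJet2.lift.mulVec Θ)).congr ?_⟩
  filter_upwards [eventually_denom_ne_zero hm.continuousAt hd] with t ht using lift_act hΘ ht

lemma lor_lift_deriv (p q : Plane) :
    lor ![p ⬝ᵥ q, q 0, q 1, 0] ![p ⬝ᵥ q, q 0, q 1, 0] = q ⬝ᵥ q := by
  simp [lor]

lemma lor_lift_lift_deriv (p q : Plane) : lor (lift p) ![p ⬝ᵥ q, q 0, q 1, 0] = 0 := by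
  simp [lor, lift]

lemma lor_add_smul (u v : Fin 4 → ℝ) (a b : ℝ) :
    lor (a • u + b • v) (a • u + b • v) = a ^ 2 * lor u u + 2 * a * b * lor u v + b ^ 2 * lor v v := by
  simp [lor]; ring

/-- The Lorentzian square of ℓ' is ‖m'‖², and adding multiples of ℓ does not change it, since ℓ is
null and orthogonal to ℓ'. Hence Θ multiplies ‖m'‖² by `denom`⁻². -/
lemma deriv_act_ne_zero (hm : ContDiffAt ℝ 2 m x) (h : deriv m x ≠ 0) (hΘ : IsLorentz Θ)
    (hd : denom Θ (m x) ≠ 0) : deriv (fun t => act Θ (m t)) x ≠ 0 := by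
  obtain ⟨a, b, hj⟩ := hasJet2_lift_act hm hΘ hd
  have hj' := (contDiffAt_act_comp hm hd).hasJet2.lift
  have e := hj'.deriv_eq.symm.trans hj.deriv_eq
  have l := congrArg (fun v => lor v v) e
  simp only [lor_lift_deriv, lor_add_smul, hΘ.lor_mulVec, lor_lift, lor_lift_lift_deriv] at l
  intro h0
  rw [h0, ← norm2_sq (deriv m x)] at l
  have h1 := norm2_pos h
  have : 0 < (denom Θ (m x))⁻¹ ^ 2 * norm2 (deriv m x) ^ 2 := by positivity
  simp at l
  simp at this
  rcases l with l | l <;> simp_all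

lemma exists_eq_vec4 {v : Fin 4 → ℝ} {p q s : ℝ} (h0 : v 0 = p) (h1 : v 1 = q) (h2 : v 2 = s) :
    ∃ r, v = ![p, q, s, r] :=
  ⟨v 3, by ext i; fin_cases i <;> simp [h0, h1, h2]⟩

/-- The frame is right equivariant. -/
theorem rhoM_act (hm : ContDiffAt ℝ 2 m x) (h : deriv m x ≠ 0) (hΘ : IsLorentz Θ)
    (hdet : Θ.det = 1) (hd : 0 < denom Θ (m x)) :
    rhoM (fun t => act Θ (m t)) x = rhoM m x * Θ⁻¹ := by
  set m' : ℝ → Plane := fun t => act Θ (m t) with hm'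
  have h' : deriv m' x ≠ 0 := deriv_act_ne_zero hm h hΘ hd.ne'
  have hA := isLorentz_rhoM h'
  have hB := isLorentz_rhoM h
  have dA := det_rhoM h'
  have dB := det_rhoM h
  set A := rhoM m' x
  set B := rhoM m x
  have hu : IsUnit Θ.det := hΘ.isUnit_det
  have huA : IsUnit A.det := hA.isUnit_det
  obtain ⟨a, b, hj⟩ := hasJet2_lift_act hm hΘ hd.ne'
  have hj' := (contDiffAt_act_comp hm hd.ne').hasJet2.lift
  have e0 := lift_act hΘ hd.ne'
  have e1 := hj'.deriv_eq.symm.trans hj.deriv_eq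
  have e2 := hj'.iteratedDeriv_two_eq.symm.trans hj.iteratedDeriv_two_eq
  have A0 : A *ᵥ lift (m' x) = _ := rhoM_mulVec_lift
  have A1 := rhoM_mulVec_deriv h'
  obtain ⟨c, A2⟩ := rhoM_mulVec_deriv_two h'
  have B0 : B *ᵥ lift (m x) = _ := rhoM_mulVec_lift
  have B1 := rhoM_mulVec_deriv h
  obtain ⟨c', B2⟩ := rhoM_mulVec_deriv_two h
  have canc : ∀ v, (B * Θ⁻¹ * A⁻¹) *ᵥ (A *ᵥ v) = (B * Θ⁻¹) *ᵥ v := fun v => by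
    rw [Matrix.mulVec_mulVec, Matrix.mul_assoc _ A⁻¹, Matrix.nonsing_inv_mul _ huA, Matrix.mul_one]
  have canc' : ∀ v, (B * Θ⁻¹) *ᵥ (Θ *ᵥ v) = B *ᵥ v := fun v => by
    rw [Matrix.mulVec_mulVec, Matrix.mul_assoc _ Θ⁻¹, Matrix.nonsing_inv_mul _ hu, Matrix.mul_one]
  have hH : IsLorentz (B * Θ⁻¹ * A⁻¹) := (hB.mul hΘ.inv).mul hA.inv
  have dH : (B * Θ⁻¹ * A⁻¹).det = 1 := by
    rw [Matrix.det_mul, Matrix.det_mul, det_inv_eq_one hdet, det_inv_eq_one dA, dB]; norm_num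
  have k0 := canc (lift (m' x))
  have k1 := canc ![m' x ⬝ᵥ deriv m' x, deriv m' x 0, deriv m' x 1, 0]
  have k2 := canc ![deriv m' x ⬝ᵥ deriv m' x + m' x ⬝ᵥ iteratedDeriv 2 m' x,
      iteratedDeriv 2 m' x 0, iteratedDeriv 2 m' x 1, 0]
  rw [A0, show lift (m' x) = _ from e0, Matrix.mulVec_smul, canc', B0] at k0
  rw [A1, e1, Matrix.mulVec_add, Matrix.mulVec_smul, Matrix.mulVec_smul, canc', canc', B0, B1] at k1
  rw [A2, e2, Matrix.mulVec_add, Matrix.mulVec_add, Matrix.mulVec_smul, Matrix.mulVec_smul,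
    Matrix.mulVec_smul, canc', canc', canc', B0, B1, B2] at k2
  have l1 := norm2_pos h
  have l1' := norm2_pos h'
  generalize norm2 (deriv m x) = l at *
  generalize norm2 (deriv m' x) = l' at *
  generalize frameEta m x 0 = η at *
  generalize frameEta m' x 0 = η' at *
  generalize denom Θ (m x) = d at *
  -- This matrix measures the discrepancy of the two frames; it maps the normalized flag of Θ·m to
  -- that of m.
  suffices hs : B * Θ⁻¹ * A⁻¹ = 1 by
    calc A = (B * Θ⁻¹ * A⁻¹) * A := by rw [hs, Matrix.one_mul]
      _ = B * Θ⁻¹ := by rw [Matrix.mul_assoc, Matrix.nonsing_inv_mul _ huA, Matrix.mul_one]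
  generalize B * Θ⁻¹ * A⁻¹ = H at *
  -- A sends the lift of Θ·m to l'e₃, while BΘ⁻¹ sends it to (l/d)e₃.
  have s0 : H *ᵥ ![0, 0, 0, 1] = ![0, 0, 0, l / d / l'] := by
    have : (![0, 0, 0, 1] : Fin 4 → ℝ) = l'⁻¹ • ![0, 0, 0, l'] := by
      ext i; fin_cases i <;> simp [l1'.ne']
    rw [this, Matrix.mulVec_smul, k0]
    ext i; fin_cases i <;> simp
    ring
  -- Here a is the coefficient of Θℓ in the derivative of the lift of Θ·m. Comparing e₃ components
  -- gives the parameter a·d + η - η'.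
  have s1 : H *ᵥ ![0, 1, 0, 0] = ![0, l / d / l', 0, l / d / l' * (a * d + η - η')] := by
    have : (![0, 1, 0, 0] : Fin 4 → ℝ) = l'⁻¹ • ![0, l', 0, l' * η'] - η' • ![0, 0, 0, 1] := by
      ext i; fin_cases i <;> simp [l1'.ne']
    rw [this, Matrix.mulVec_sub, Matrix.mulVec_smul, Matrix.mulVec_smul, k1, s0]
    ext i; fin_cases i <;> simp <;> field_simp
  have s2 : ∃ r, H *ᵥ ![1, 0, 0, 0] = ![l / d / l', 2 * (l / d / l') * (a * d + η - η'), 0, r] := by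
    have : (![1, 0, 0, 0] : Fin 4 → ℝ) = l'⁻¹ • ![l', 2 * l' * η', 0, c] - (2 * η') • ![0, 1, 0, 0]
        - (l'⁻¹ * c) • ![0, 0, 0, 1] := by
      ext i; fin_cases i <;> simp [l1'.ne']
      field_simp; simp
    rw [this, Matrix.mulVec_sub, Matrix.mulVec_sub, Matrix.mulVec_smul, Matrix.mulVec_smul,
      Matrix.mulVec_smul, k2, s0, s1]
    refine exists_eq_vec4 ?_ ?_ ?_
    · simp; field_simp
    · simp; field_simp
    · simp
  obtain ⟨r, s2⟩ := s2
  exact hH.eq_one_of_flag dH (by positivity) s0 s1 s2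

end Equivariance

/-! ### The Maurer-Cartan matrix -/

/-- Entrywise derivative of a matrix valued function. -/
def HasEntryDerivAt (A : ℝ → Matrix (Fin 4) (Fin 4) ℝ) (A' : Matrix (Fin 4) (Fin 4) ℝ) (x : ℝ) :
    Prop :=
  ∀ i j, HasDerivAt (fun t => A t i j) (A' i j) x

lemma HasEntryDerivAt.mul {A B : ℝ → Matrix (Fin 4) (Fin 4) ℝ} {A' B' : Matrix (Fin 4) (Fin 4) ℝ}
    {x : ℝ} (hA : HasEntryDerivAt A A' x) (hB : HasEntryDerivAt B B' x) :
    HasEntryDerivAt (fun t => A t * B t) (A' * B x + A x * B') x := by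
  intro i j
  simp only [Matrix.mul_apply, Matrix.add_apply, ← Finset.sum_add_distrib]
  exact HasDerivAt.fun_sum fun k _ => (hA i k).mul (hB k j)

/-- Each factor's derivative is recorded as X * g with X in the Lie algebra, so that the terms of
the product rule can all be moved to the left. -/
lemma hasEntryDerivAt_gOne {η : ℝ → Plane} {ζ : Plane} {x : ℝ}
    (h : ∀ i, HasDerivAt (fun t => η t i) (ζ i) x) :
    HasEntryDerivAt (fun t => gOne (η t))
      (!![0, 0, 0, 0; ζ 0, 0, 0, 0; ζ 1, 0, 0, 0; 0, ζ 0, ζ 1, 0] * gOne (η x)) x := by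
  have h0 := h 0
  have h1 := h 1
  intro i j
  fin_cases i <;> fin_cases j
  all_goals
    simp [gOne, Matrix.mul_apply, Fin.sum_univ_four]
    try first | exact hasDerivAt_const x _ | exact h0 | exact h1 |
      exact (((h0.fun_mul h0).fun_add (h1.fun_mul h1)).div_const 2).congr_deriv (by ring)

lemma hasEntryDerivAt_gMinusOne {m : ℝ → Plane} {q : Plane} {x : ℝ}
    (h : ∀ i, HasDerivAt (fun t => m t i) (q i) x) :
    HasEntryDerivAt (fun t => gMinusOne (-m t))
      (!![0, -q 0, -q 1, 0; 0, 0, 0, -q 0; 0, 0, 0, -q 1; 0, 0, 0, 0] * gMinusOne (-m x)) x := by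
  have h0 := h 0
  have h1 := h 1
  intro i j
  fin_cases i <;> fin_cases j
  all_goals
    simp [gMinusOne, Matrix.mul_apply, Fin.sum_univ_four]
    try first | exact hasDerivAt_const x _ | exact h0.neg | exact h1.neg |
      exact (((h0.fun_mul h0).fun_add (h1.fun_mul h1)).div_const 2).congr_deriv (by ring)

/-- σ is the logarithmic derivative of the scale l and τ the angular velocity of (c, s). -/
lemma hasEntryDerivAt_gZero {l c s : ℝ → ℝ} {l' σ τ : ℝ} {x : ℝ}
    (hl : HasDerivAt l l' x) (hl' : l' = σ * l x) (hx : l x ≠ 0)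
    (hc : HasDerivAt c (-(τ * s x)) x) (hs : HasDerivAt s (τ * c x) x) :
    HasEntryDerivAt (fun t => gZero (l t)⁻¹ !![c t, s t; -s t, c t])
      (!![-σ, 0, 0, 0; 0, 0, τ, 0; 0, -τ, 0, 0; 0, 0, 0, σ] *
        gZero (l x)⁻¹ !![c x, s x; -s x, c x]) x := by
  subst hl'
  intro i j
  fin_cases i <;> fin_cases j
  case _ =>
    simp [gZero, Matrix.mul_apply, Fin.sum_univ_four]
    exact (hl.fun_inv hx).congr_deriv (by field_simp)
  all_goals
    simp [gZero, Matrix.mul_apply, Fin.sum_univ_four]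
    try first | exact hasDerivAt_const x _ | exact hc | exact hs | exact hs.neg | exact hl

lemma hasDerivAt_dot {p q : ℝ → Plane} {p' q' : Plane} {x : ℝ}
    (hp : ∀ i, HasDerivAt (fun t => p t i) (p' i) x)
    (hq : ∀ i, HasDerivAt (fun t => q t i) (q' i) x) :
    HasDerivAt (fun t => p t ⬝ᵥ q t) (p' ⬝ᵥ q x + p x ⬝ᵥ q') x := by
  simp only [dot_eq]
  exact (((hp 0).mul (hq 0)).add ((hp 1).mul (hq 1))).congr_deriv (by ring)

lemma hasDerivAt_det2 {p q : ℝ → Plane} {p' q' : Plane} {x : ℝ}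
    (hp : ∀ i, HasDerivAt (fun t => p t i) (p' i) x)
    (hq : ∀ i, HasDerivAt (fun t => q t i) (q' i) x) :
    HasDerivAt (fun t => det2 (p t) (q t)) (det2 p' (q x) + det2 (p x) q') x := by
  simp only [det2]
  exact (((hp 0).mul (hq 1)).sub ((hp 1).mul (hq 0))).congr_deriv (by ring)

section Frame

variable {m : ℝ → Plane} {x : ℝ}

lemma contDiffAt_iteratedDeriv {E : Type*} [NormedAddCommGroup E] [NormedSpace ℝ E]
    {k : WithTop ℕ∞} (n : ℕ) {f : ℝ → E} {x : ℝ} (h : ContDiffAt ℝ (k + n) f x) :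
    ContDiffAt ℝ k (iteratedDeriv n f) x := by
  induction n generalizing f with
  | zero => simpa using h
  | succ n ih =>
    rw [iteratedDeriv_succ']
    exact ih (contDiffAt_deriv (by simpa [add_assoc] using h))

lemma hasDerivAt_iteratedDeriv {n : ℕ} (hm : ContDiffAt ℝ (n + 1 : ℕ) m x) (i : Fin 2) :
    HasDerivAt (fun t => iteratedDeriv n m t i) (iteratedDeriv (n + 1) m x i) x := by
  have h : HasDerivAt (iteratedDeriv n m) (iteratedDeriv (n + 1) m x) x := by
    rw [iteratedDeriv_succ]
    refine ((contDiffAt_iteratedDeriv (k := 1) n ?_).differentiableAt one_ne_zero).hasDerivAt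
    rw [add_comm]; exact_mod_cast hm
  exact hasDerivAt_pi.1 h i

theorem hasEntryDerivAt_rhoM (hm : ContDiffAt ℝ 3 m x) (h : deriv m x ≠ 0) :
    HasEntryDerivAt (rhoM m) (formKL 1 (kappa1 m x) (kappa2 m x) * rhoM m x) x := by
  have hp := hasDerivAt_iteratedDeriv (n := 0) (hm.of_le (by norm_num))
  have hq := hasDerivAt_iteratedDeriv (n := 1) (hm.of_le (by norm_num))
  have hr := hasDerivAt_iteratedDeriv (n := 2) hm
  simp only [iteratedDeriv_zero, iteratedDeriv_one, zero_add, Nat.reduceAdd] at hp hq hr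
  have l0 := norm2_pos h
  have l2 := norm2_sq (deriv m x)
  have hl : HasDerivAt (fun t => norm2 (deriv m t))
      ((deriv m x ⬝ᵥ iteratedDeriv 2 m x) / norm2 (deriv m x)) x := by
    refine ((hasDerivAt_dot hq hq).sqrt ?_).congr_deriv ?_
    · rw [← l2]; positivity
    · rw [show Real.sqrt (deriv m x ⬝ᵥ deriv m x) = norm2 (deriv m x) from rfl, dotProduct_comm]
      field_simp; ring
  -- The angular velocity of the unit tangent is det(m' m'')/‖m'‖², that is `-frameEta m x 1`.
  have hc : HasDerivAt (fun t => deriv m t 0 / norm2 (deriv m t))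
      (-(-frameEta m x 1 * (deriv m x 1 / norm2 (deriv m x)))) x := by
    refine ((hq 0).fun_div hl l0.ne').congr_deriv ?_
    simp [-Matrix.vec2_dotProduct, frameEta]
    field_simp
    rw [l2, dot_eq, dot_eq, det2]
    ring
  have hs : HasDerivAt (fun t => deriv m t 1 / norm2 (deriv m t))
      (-frameEta m x 1 * (deriv m x 0 / norm2 (deriv m x))) x := by
    refine ((hq 1).fun_div hl l0.ne').congr_deriv ?_
    simp [-Matrix.vec2_dotProduct, frameEta]
    field_simp
    rw [l2, dot_eq, dot_eq, det2]
    ring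
  -- Riccati equations for η, equivalent to the formulas for κ₁ and κ₂. Their quadratic terms cancel
  -- those produced by moving the other factors past `gOne`.
  have hη : ∀ i, HasDerivAt (fun t => frameEta m t i)
      (![-kappa1 m x + (frameEta m x 0 ^ 2 - frameEta m x 1 ^ 2) / 2,
        -kappa2 m x + frameEta m x 0 * frameEta m x 1] i) x := by
    have hd := hasDerivAt_dot hq hr
    have he := hasDerivAt_det2 hq hr
    have hl2 := hl.fun_pow 2
    -- Lagrange's identity removes ‖m''‖², which does not occur in κ₁.
    have lag : (iteratedDeriv 2 m x ⬝ᵥ iteratedDeriv 2 m x) * norm2 (deriv m x) ^ 2 =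
        (deriv m x ⬝ᵥ iteratedDeriv 2 m x) ^ 2 + det2 (deriv m x) (iteratedDeriv 2 m x) ^ 2 := by
      rw [l2, dot_eq, dot_eq, dot_eq, det2]; ring
    have self : det2 (iteratedDeriv 2 m x) (iteratedDeriv 2 m x) = 0 := by simp [det2]; ring
    intro i
    fin_cases i
    · refine (hd.fun_div hl2 (by positivity)).congr_deriv ?_
      simp [-Matrix.vec2_dotProduct, frameEta, kappa1]
      field_simp
      linear_combination 2 * lag
    · refine (he.fun_neg.fun_div hl2 (by positivity)).congr_deriv ?_
      rw [self]
      simp [-Matrix.vec2_dotProduct, frameEta, kappa2]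
      field_simp
      ring
  have hσ : (deriv m x ⬝ᵥ iteratedDeriv 2 m x) / norm2 (deriv m x)
      = frameEta m x 0 * norm2 (deriv m x) := by
    simp [-Matrix.vec2_dotProduct, frameEta]; field_simp
  have key := ((hasEntryDerivAt_gOne hη).mul
    (hasEntryDerivAt_gZero (c := fun t => deriv m t 0 / norm2 (deriv m t))
      (s := fun t => deriv m t 1 / norm2 (deriv m t)) hl hσ l0.ne' hc hs)).mul
    (hasEntryDerivAt_gMinusOne hp)
  have e : (fun t => gOne (frameEta m t) * gZero (norm2 (deriv m t))⁻¹
      !![deriv m t 0 / norm2 (deriv m t), deriv m t 1 / norm2 (deriv m t);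
      -(deriv m t 1 / norm2 (deriv m t)), deriv m t 0 / norm2 (deriv m t)] * gMinusOne (-m t)) =
      rhoM m := by
    ext t : 1
    rw [rhoM, frameB_eq]
  rw [e] at key
  convert key using 1
  rw [rhoM, frameB_eq]
  -- Moving the translation velocity past `gZero` scales and rotates m' to the unit vector (1, 0);
  -- hence the constant k₀ = 1 in K_M.
  have hN : gZero (norm2 (deriv m x))⁻¹
      !![deriv m x 0 / norm2 (deriv m x), deriv m x 1 / norm2 (deriv m x);
      -(deriv m x 1 / norm2 (deriv m x)), deriv m x 0 / norm2 (deriv m x)] *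
      !![0, -deriv m x 0, -deriv m x 1, 0; 0, 0, 0, -deriv m x 0; 0, 0, 0, -deriv m x 1; 0, 0, 0, 0]
      = !![0, -1, 0, 0; 0, 0, 0, -1; 0, 0, 0, 0; 0, 0, 0, 0] * gZero (norm2 (deriv m x))⁻¹
      !![deriv m x 0 / norm2 (deriv m x), deriv m x 1 / norm2 (deriv m x);
      -(deriv m x 1 / norm2 (deriv m x)), deriv m x 0 / norm2 (deriv m x)] := by
    rw [dot_self] at l2
    ext i j
    fin_cases i <;> fin_cases j <;> simp [gZero, Matrix.mul_apply, Fin.sum_univ_four] <;>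
      field_simp <;> linarith
  generalize gZero (norm2 (deriv m x))⁻¹
      !![deriv m x 0 / norm2 (deriv m x), deriv m x 1 / norm2 (deriv m x);
      -(deriv m x 1 / norm2 (deriv m x)), deriv m x 0 / norm2 (deriv m x)] = G at *
  have hN' : ∀ X, G * (!![0, -deriv m x 0, -deriv m x 1, 0; 0, 0, 0, -deriv m x 0;
      0, 0, 0, -deriv m x 1; 0, 0, 0, 0] * X) =
      !![0, -1, 0, 0; 0, 0, 0, -1; 0, 0, 0, 0; 0, 0, 0, 0] * (G * X) := fun X => by
    rw [← Matrix.mul_assoc, hN, Matrix.mul_assoc]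
  simp only [Matrix.add_mul, Matrix.mul_assoc, hN']
  generalize G * gMinusOne (-m x) = X
  simp only [← Matrix.mul_assoc, ← Matrix.add_mul]
  congr 1
  generalize frameEta m x = η
  generalize kappa1 m x = k1
  generalize kappa2 m x = k2
  ext i j
  fin_cases i <;> fin_cases j <;>
    simp [gOne, formKL, Matrix.mul_apply, Fin.sum_univ_four] <;> ring

theorem KM_eq (hm : ContDiffAt ℝ 3 m x) (h : deriv m x ≠ 0) :
    KM m x = formKL 1 (kappa1 m x) (kappa2 m x) := by
  have : (Matrix.of fun i j => deriv (fun t => rhoM m t i j) x) =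
      formKL 1 (kappa1 m x) (kappa2 m x) * rhoM m x := by
    ext i j
    exact (hasEntryDerivAt_rhoM hm h i j).deriv
  rw [KM, this, Matrix.mul_assoc, Matrix.mul_nonsing_inv _ (isLorentz_rhoM h).isUnit_det,
    Matrix.mul_one]

end Frame

/-! ### Invariance of the curvatures -/

lemma iteratedDeriv_clm {E F : Type*} [NormedAddCommGroup E] [NormedSpace ℝ E]
    [NormedAddCommGroup F] [NormedSpace ℝ F] (L : E ≃L[ℝ] F) (n : ℕ) (f : ℝ → E) (x : ℝ) :
    iteratedDeriv n (fun t => L (f t)) x = L (iteratedDeriv n f x) := by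
  have := L.iteratedFDeriv_comp_left (f := f) (x := x) (i := n)
  rw [iteratedDeriv_eq_iteratedFDeriv, iteratedDeriv_eq_iteratedFDeriv]
  exact congrArg (fun v => v fun _ => (1 : ℝ)) this

/-- The reflection of the plane in the first coordinate axis. -/
noncomputable def reflect : Plane ≃L[ℝ] Plane :=
  (LinearEquiv.ofInvolutive
    ({ toFun := fun p => ![p 0, -p 1]
       map_add' := fun p q => by ext i; fin_cases i <;> simp; ring
       map_smul' := fun c p => by ext i; fin_cases i <;> simp } : Plane →ₗ[ℝ] Plane)
    (fun p => by ext i; fin_cases i <;> simp)).toContinuousLinearEquiv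

lemma reflect_apply (p : Plane) : reflect p = ![p 0, -p 1] := rfl

/-- The Lorentz matrix of the reflection. -/
noncomputable def reflectMatrix : Matrix (Fin 4) (Fin 4) ℝ := Matrix.diagonal ![1, 1, -1, 1]

lemma isLorentz_reflectMatrix : IsLorentz reflectMatrix := by
  ext i j
  fin_cases i <;> fin_cases j <;>
    simp [reflectMatrix, J, Matrix.mul_apply, Matrix.diagonal]

lemma det_reflectMatrix : reflectMatrix.det = -1 := by
  simp [reflectMatrix, Matrix.det_diagonal, Fin.prod_univ_four]

lemma reflectMatrix_mulVec_lift (p : Plane) : reflectMatrix *ᵥ lift (reflect p) = lift p := by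
  ext i
  fin_cases i <;> simp [reflectMatrix, reflect_apply, Matrix.mulVec_diagonal, lift]

section Invariance

variable {m : ℝ → Plane} {x : ℝ} {Θ : Matrix (Fin 4) (Fin 4) ℝ}

/-- A reflection preserves dot products and reverses `det2`; κ₁ is even in `det2` and κ₂ is odd. -/
lemma kappa_reflect (m : ℝ → Plane) (x : ℝ) :
    kappa1 (fun t => reflect (m t)) x = kappa1 m x ∧
      kappa2 (fun t => reflect (m t)) x = -kappa2 m x := by
  have e1 : deriv (fun t => reflect (m t)) x = reflect (deriv m x) := by
    simpa only [iteratedDeriv_one] using iteratedDeriv_clm reflect 1 m x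
  have hdot : ∀ p q, reflect p ⬝ᵥ reflect q = p ⬝ᵥ q := fun p q => by
    simp [reflect_apply]
  have hdet : ∀ p q, det2 (reflect p) (reflect q) = -det2 p q := fun p q => by
    simp [reflect_apply, det2]; ring
  have hn : ∀ p, norm2 (reflect p) = norm2 p := fun p => by rw [norm2, hdot, norm2]
  simp only [kappa1, kappa2, e1, iteratedDeriv_clm, hdot, hdet, hn]
  constructor <;> ring

lemma denom_neg (p : Plane) : denom (-Θ) p = -denom Θ p := by
  simp [denom, Matrix.neg_mulVec]

lemma act_neg (p : Plane) : act (-Θ) p = act Θ p := by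
  simp [act, proj, Matrix.neg_mulVec, neg_div_neg_eq]

/-- Right multiplication of the frame by the constant Θ⁻¹ leaves ρ'ρ⁻¹ unchanged. Equivariance is
needed on a neighbourhood, in order to differentiate it. -/
lemma kappa_act_of_pos (hm : ContDiffAt ℝ 3 m x) (h : deriv m x ≠ 0) (hΘ : IsLorentz Θ)
    (hdet : Θ.det = 1) (hd : 0 < denom Θ (m x)) :
    kappa1 (fun t => act Θ (m t)) x = kappa1 m x ∧
      kappa2 (fun t => act Θ (m t)) x = kappa2 m x := by
  have hm2 : ContDiffAt ℝ 2 m x := hm.of_le (by norm_num)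
  have h' := deriv_act_ne_zero hm2 h hΘ hd.ne'
  have hA := hasEntryDerivAt_rhoM (contDiffAt_act_comp hm hd.ne') h'
  have hC : HasEntryDerivAt (fun _ => Θ⁻¹) 0 x := fun i j => hasDerivAt_const x (Θ⁻¹ i j)
  have hB := (hasEntryDerivAt_rhoM hm h).mul hC
  have hev : ∀ᶠ t in 𝓝 x, rhoM (fun t => act Θ (m t)) t = rhoM m t * Θ⁻¹ := by
    have c1 : ContinuousAt (deriv m) x := (contDiffAt_deriv (n := 1) hm2).continuousAt
    have c2 : ContinuousAt (fun t => denom Θ (m t)) x :=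
      ((contDiff_mulVec_lift (n := 0) Θ 3).continuous.continuousAt.comp hm.continuousAt)
    filter_upwards [hm2.eventually (by simp), c1.eventually_ne h,
      c2.eventually (lt_mem_nhds hd)] with t t1 t2 t3 using rhoM_act t1 t2 hΘ hdet t3
  have e : formKL 1 (kappa1 (fun t => act Θ (m t)) x) (kappa2 (fun t => act Θ (m t)) x) *
      rhoM (fun t => act Θ (m t)) x = formKL 1 (kappa1 m x) (kappa2 m x) *
      rhoM (fun t => act Θ (m t)) x := by
    rw [hev.self_of_nhds, ← Matrix.mul_assoc]
    ext i j
    have hBij := (hB i j).congr_of_eventuallyEq 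
      (hev.mono fun t ht => congrFun (congrFun ht i) j)
    have := (hA i j).unique hBij
    rw [hev.self_of_nhds, ← Matrix.mul_assoc, Matrix.mul_zero, add_zero] at this
    rwa [← Matrix.mul_assoc]
  have e' := congrArg (· * (rhoM (fun t => act Θ (m t)) x)⁻¹) e
  simp only [Matrix.mul_assoc, Matrix.mul_nonsing_inv _ (isLorentz_rhoM h').isUnit_det,
    Matrix.mul_one] at e'
  have e10 := congrFun (congrFun e' 1) 0
  have e20 := congrFun (congrFun e' 2) 0
  simp [formKL] at e10 e20
  exact ⟨e10, e20⟩

/-- In even dimension -Θ has the same determinant as Θ, and it acts identically with the opposite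
denominator. -/
lemma kappa_act_of_det_one (hm : ContDiffAt ℝ 3 m x) (h : deriv m x ≠ 0) (hΘ : IsLorentz Θ)
    (hdet : Θ.det = 1) (hd : denom Θ (m x) ≠ 0) :
    kappa1 (fun t => act Θ (m t)) x = kappa1 m x ∧
      kappa2 (fun t => act Θ (m t)) x = kappa2 m x := by
  rcases hd.lt_or_gt with hneg | hpos
  · have := kappa_act_of_pos (Θ := -Θ) hm h hΘ.neg (by simp [Matrix.det_neg, hdet]; norm_num)
      (by rw [denom_neg]; linarith)
    simpa only [act_neg] using this
  · exact kappa_act_of_pos hm h hΘ hdet hpos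

theorem kappa_act (hm : ContDiffAt ℝ 3 m x) (h : deriv m x ≠ 0) (hΘ : IsLorentz Θ)
    (hd : denom Θ (m x) ≠ 0) :
    kappa1 (fun t => act Θ (m t)) x = kappa1 m x ∧
      kappa2 (fun t => act Θ (m t)) x = Θ.det * kappa2 m x := by
  rcases mul_self_eq_one_iff.1 hΘ.det_sq with hdet | hdet
  · rw [hdet, one_mul]
    exact kappa_act_of_det_one hm h hΘ hdet hd
  -- Θ acts on m as `Θ * reflectMatrix`, of determinant 1, acts on the reflected curve.
  · have e : ∀ p, (Θ * reflectMatrix) *ᵥ lift (reflect p) = Θ *ᵥ lift p := fun p => by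
      rw [← Matrix.mulVec_mulVec, reflectMatrix_mulVec_lift]
    have ea : ∀ p, act (Θ * reflectMatrix) (reflect p) = act Θ p := fun p => by rw [act, e, act]
    have hr : deriv (fun t => reflect (m t)) x ≠ 0 := by
      have := iteratedDeriv_clm reflect 1 m x
      rw [iteratedDeriv_one, iteratedDeriv_one] at this
      rw [this]; simpa using h
    have key := kappa_act_of_det_one (Θ := Θ * reflectMatrix) (m := fun t => reflect (m t))
      (reflect.contDiff.contDiffAt.comp x hm) hr
      (hΘ.mul isLorentz_reflectMatrix) (by rw [Matrix.det_mul, hdet, det_reflectMatrix]; norm_num)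
      (by rw [denom, e]; exact hd)
    simp only [ea] at key
    rw [key.1, key.2, (kappa_reflect m x).1, (kappa_reflect m x).2, hdet]
    simp

theorem iteratedDeriv_kappa_act (n : ℕ) (hm : ContDiffAt ℝ ((n + 3 : ℕ) : WithTop ℕ∞) m x)
    (h : deriv m x ≠ 0) (hΘ : IsLorentz Θ) (hd : denom Θ (m x) ≠ 0) :
    iteratedDeriv n (kappa1 (fun t => act Θ (m t))) x = iteratedDeriv n (kappa1 m) x ∧
      iteratedDeriv n (kappa2 (fun t => act Θ (m t))) x
        = Θ.det * iteratedDeriv n (kappa2 m) x := by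
  have hm3 : ContDiffAt ℝ 3 m x := hm.of_le (by exact_mod_cast Nat.le_add_left 3 n)
  have hev : ∀ᶠ t in 𝓝 x, kappa1 (fun t => act Θ (m t)) t = kappa1 m t ∧
      kappa2 (fun t => act Θ (m t)) t = Θ.det * kappa2 m t := by
    have c1 : ContinuousAt (deriv m) x :=
      (contDiffAt_deriv (n := 1) (hm3.of_le (by norm_num))).continuousAt
    filter_upwards [hm3.eventually (by simp), c1.eventually_ne h,
      eventually_denom_ne_zero hm.continuousAt hd] with t t1 t2 t3 using kappa_act t1 t2 hΘ t3
  constructor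
  · exact Filter.EventuallyEq.iteratedDeriv_eq n (hev.mono fun t ht => ht.1)
  · rw [Filter.EventuallyEq.iteratedDeriv_eq n (g := fun t => Θ.det * kappa2 m t)
      (hev.mono fun t ht => ht.2)]
    exact iteratedDeriv_const_mul_field Θ.det (kappa2 m)

end Invariance

/-! ### The Schwarzian derivative of a complex curve -/

lemma iteratedDeriv_iteratedDeriv {E : Type*} [NormedAddCommGroup E] [NormedSpace ℝ E] (i j : ℕ)
    (f : ℝ → E) : iteratedDeriv i (iteratedDeriv j f) = iteratedDeriv (i + j) f := by
  simp only [iteratedDeriv_eq_iterate, Function.iterate_add_apply]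

lemma contDiffAt_infty_iteratedDeriv {E : Type*} [NormedAddCommGroup E] [NormedSpace ℝ E]
    (n : ℕ) {f : ℝ → E} {x : ℝ} (h : ContDiffAt ℝ ∞ f x) :
    ContDiffAt ℝ ∞ (iteratedDeriv n f) x :=
  contDiffAt_iteratedDeriv n (by exact_mod_cast h)

lemma contDiffAt_complex_div {E : Type*} [NormedAddCommGroup E] [NormedSpace ℝ E] {f g : E → ℂ}
    {x : E} {n : WithTop ℕ∞} (hf : ContDiffAt ℝ n f x) (hg : ContDiffAt ℝ n g x) (h : g x ≠ 0) :
    ContDiffAt ℝ n (fun t => f t / g t) x := by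
  simp only [div_eq_mul_inv]
  exact hf.mul (hg.inv h)

/-- The Schwarzian derivative. -/
noncomputable def schwarzian (z : ℝ → ℂ) (t : ℝ) : ℂ :=
  iteratedDeriv 3 z t / deriv z t
    - ((3 / 2 : ℝ) : ℂ) * (iteratedDeriv 2 z t / deriv z t) ^ 2

section Schwarzian

variable {z z₁ z₂ : ℝ → ℂ} {x : ℝ}

lemma contDiffAt_schwarzian (hz : ContDiffAt ℝ ∞ z x) (h : deriv z x ≠ 0) :
    ContDiffAt ℝ ∞ (schwarzian z) x := by
  have h1 := contDiffAt_infty_iteratedDeriv 1 hz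
  rw [iteratedDeriv_one] at h1
  have h2 := contDiffAt_infty_iteratedDeriv 2 hz
  have h3 := contDiffAt_infty_iteratedDeriv 3 hz
  exact (contDiffAt_complex_div h3 h1 h).sub (contDiffAt_const.mul ((contDiffAt_complex_div h2 h1 h).pow 2))

/-- In Leibniz's formula every term with fewer than n derivatives on f vanishes. -/
lemma iteratedDeriv_mul_of_vanishing {f g : ℝ → ℂ} {n : ℕ} (hf : ContDiffAt ℝ ∞ f x)
    (hg : ContDiffAt ℝ ∞ g x) (h : ∀ i < n, iteratedDeriv i f x = 0) :
    iteratedDeriv n (fun t => f t * g t) x = iteratedDeriv n f x * g x := by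
  have hle : (n : WithTop ℕ∞) ≤ ∞ := by exact_mod_cast le_top
  rw [iteratedDeriv_fun_mul (hf.of_le hle) (hg.of_le hle), Finset.sum_eq_single n]
  · simp
  · intro i hi hin
    rw [h i (by have := Finset.mem_range.1 hi; omega)]
    simp
  · simp

/-- The top order dependence of the derivatives of the Schwarzian on the curve. -/
lemma iteratedDeriv_schwarzian_sub (n : ℕ) (hz₁ : ContDiffAt ℝ ∞ z₁ x) (hz₂ : ContDiffAt ℝ ∞ z₂ x)
    (h : deriv z₁ x ≠ 0) (hj : ∀ i < n + 3, iteratedDeriv i z₁ x = iteratedDeriv i z₂ x) :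
    iteratedDeriv n (schwarzian z₁) x - iteratedDeriv n (schwarzian z₂) x =
      (iteratedDeriv (n + 3) z₁ x - iteratedDeriv (n + 3) z₂ x) / deriv z₁ x := by
  have hle : ∀ k : ℕ, (k : WithTop ℕ∞) ≤ ∞ := fun k => by exact_mod_cast le_top
  have h' : deriv z₂ x ≠ 0 := by
    have := hj 1 (by omega)
    rw [iteratedDeriv_one, iteratedDeriv_one] at this
    rwa [← this]
  have c₁ : ∀ k, ContDiffAt ℝ ∞ (iteratedDeriv k z₁) x := fun k =>
    contDiffAt_infty_iteratedDeriv k hz₁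
  have c₂ : ∀ k, ContDiffAt ℝ ∞ (iteratedDeriv k z₂) x := fun k =>
    contDiffAt_infty_iteratedDeriv k hz₂
  have d₁ : ContDiffAt ℝ ∞ (deriv z₁) x := by simpa only [iteratedDeriv_one] using c₁ 1
  have d₂ : ContDiffAt ℝ ∞ (deriv z₂) x := by simpa only [iteratedDeriv_one] using c₂ 1
  have hD : ∀ k, ContDiffAt ℝ ∞ (fun t => iteratedDeriv k z₁ t - iteratedDeriv k z₂ t) x :=
    fun k => (c₁ k).sub (c₂ k)
  have hDj : ∀ i k, iteratedDeriv i (fun t => iteratedDeriv k z₁ t - iteratedDeriv k z₂ t) x =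
      iteratedDeriv (i + k) z₁ x - iteratedDeriv (i + k) z₂ x := fun i k => by
    rw [iteratedDeriv_fun_sub ((c₁ k).of_le (hle i)) ((c₂ k).of_le (hle i)),
      iteratedDeriv_iteratedDeriv, iteratedDeriv_iteratedDeriv]
  have hq : ContDiffAt ℝ ∞ (fun t => ((3 / 2 : ℝ) : ℂ) *
      (iteratedDeriv 2 z₁ t / deriv z₁ t + iteratedDeriv 2 z₂ t / deriv z₂ t)) x :=
    contDiffAt_const.mul ((contDiffAt_complex_div (c₁ 2) d₁ h).add (contDiffAt_complex_div (c₂ 2) d₂ h'))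
  have g₃ : ContDiffAt ℝ ∞ (fun t => (deriv z₁ t)⁻¹) x := d₁.inv h
  have g₂ : ContDiffAt ℝ ∞ (fun t => -(((3 / 2 : ℝ) : ℂ) *
      (iteratedDeriv 2 z₁ t / deriv z₁ t + iteratedDeriv 2 z₂ t / deriv z₂ t)) * (deriv z₁ t)⁻¹) x :=
    hq.neg.mul g₃
  have g₁ : ContDiffAt ℝ ∞ (fun t => ((((3 / 2 : ℝ) : ℂ) *
      (iteratedDeriv 2 z₁ t / deriv z₁ t + iteratedDeriv 2 z₂ t / deriv z₂ t)) * iteratedDeriv 2 z₂ t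
        - iteratedDeriv 3 z₂ t) * ((deriv z₁ t)⁻¹ * (deriv z₂ t)⁻¹)) x :=
    ((hq.mul (c₂ 2)).sub (c₂ 3)).mul (g₃.mul (d₂.inv h'))
  -- The difference is a combination, with smooth coefficients, of the differences of third, second
  -- and first derivatives. At x these vanish to orders n, n + 1, n + 2, so only the third-order
  -- term survives n differentiations.
  have e : (fun t => schwarzian z₁ t - schwarzian z₂ t) =ᶠ[𝓝 x] fun t =>
      ((iteratedDeriv 3 z₁ t - iteratedDeriv 3 z₂ t) * (deriv z₁ t)⁻¹ +
      (iteratedDeriv 2 z₁ t - iteratedDeriv 2 z₂ t) * (-(((3 / 2 : ℝ) : ℂ) *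
      (iteratedDeriv 2 z₁ t / deriv z₁ t + iteratedDeriv 2 z₂ t / deriv z₂ t)) * (deriv z₁ t)⁻¹)) +
      (iteratedDeriv 1 z₁ t - iteratedDeriv 1 z₂ t) * (((((3 / 2 : ℝ) : ℂ) *
      (iteratedDeriv 2 z₁ t / deriv z₁ t + iteratedDeriv 2 z₂ t / deriv z₂ t)) * iteratedDeriv 2 z₂ t
        - iteratedDeriv 3 z₂ t) * ((deriv z₁ t)⁻¹ * (deriv z₂ t)⁻¹)) := by
    filter_upwards [d₁.continuousAt.eventually_ne h, d₂.continuousAt.eventually_ne h'] with t t1 t2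
    simp only [schwarzian, iteratedDeriv_one]
    field_simp
    ring
  have p₃ := (hD 3).mul g₃
  have p₂ := (hD 2).mul g₂
  have p₁ := (hD 1).mul g₁
  rw [← iteratedDeriv_fun_sub ((contDiffAt_schwarzian hz₁ h).of_le (hle n))
    ((contDiffAt_schwarzian hz₂ h').of_le (hle n)), e.iteratedDeriv_eq n,
    iteratedDeriv_fun_add ((p₃.add p₂).of_le (hle n)) (p₁.of_le (hle n)),
    iteratedDeriv_fun_add (p₃.of_le (hle n)) (p₂.of_le (hle n)),
    iteratedDeriv_mul_of_vanishing (hD 3) g₃, iteratedDeriv_mul_of_vanishing (hD 2) g₂,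
    iteratedDeriv_mul_of_vanishing (hD 1) g₁, hDj, hDj, hDj, hj (n + 2) (by omega),
    hj (n + 1) (by omega)]
  · simp [div_eq_mul_inv]
  all_goals
    intro i hi
    rw [hDj, hj _ (by omega), sub_self]

/-- A curve is determined to any order by its 2-jet and its Schwarzian. -/
lemma iteratedDeriv_eq_of_schwarzian (n : ℕ) (hz₁ : ContDiffAt ℝ ∞ z₁ x)
    (hz₂ : ContDiffAt ℝ ∞ z₂ x) (h : deriv z₁ x ≠ 0)
    (hj : ∀ i < 3, iteratedDeriv i z₁ x = iteratedDeriv i z₂ x)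
    (hs : ∀ i < n, iteratedDeriv i (schwarzian z₁) x = iteratedDeriv i (schwarzian z₂) x) :
    ∀ i < n + 3, iteratedDeriv i z₁ x = iteratedDeriv i z₂ x := by
  induction n with
  | zero => simpa using hj
  | succ n ih =>
    have hn := ih fun i hi => hs i (by omega)
    intro i hi
    rcases (by omega : i < n + 3 ∨ i = n + 3) with hi | rfl
    · exact hn i hi
    · have := iteratedDeriv_schwarzian_sub n hz₁ hz₂ h hn
      rw [hs n (by omega), sub_self] at this
      rcases div_eq_zero_iff.1 this.symm with h0 | h0
      · exact sub_eq_zero.1 h0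
      · exact absurd h0 h

end Schwarzian

/-! ### Smooth dependence of derivatives on parameters -/

section Parameters

variable {E F : Type*} [NormedAddCommGroup E] [NormedSpace ℝ E] [NormedAddCommGroup F]
  [NormedSpace ℝ F]

lemma contDiffAt_param_deriv {f : E → ℝ → F} {q : E × ℝ}
    (hf : ContDiffAt ℝ ∞ (fun q : E × ℝ => f q.1 q.2) q) :
    ContDiffAt ℝ ∞ (fun q : E × ℝ => deriv (f q.1) q.2) q := by
  -- The whole pair q serves as parameter and t is a separate variable, later evaluated at `q.2`.
  have h1 : ContDiffAt ℝ ∞ (Function.uncurry fun (q : E × ℝ) (t : ℝ) => f q.1 t) (q, q.2) := by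
    have hg : ContDiffAt ℝ ∞ (fun r : (E × ℝ) × ℝ => ((r.1.1, r.2) : E × ℝ)) (q, q.2) := by
      fun_prop
    exact ContDiffAt.comp (q, q.2) (g := fun q : E × ℝ => f q.1 q.2) hf hg
  exact (ContDiffAt.fderiv (m := ∞) h1 contDiffAt_snd (by simp)).clm_apply contDiffAt_const

lemma contDiffAt_param_iteratedDeriv (n : ℕ) {f : E → ℝ → F} {q : E × ℝ}
    (hf : ContDiffAt ℝ ∞ (fun q : E × ℝ => f q.1 q.2) q) :
    ContDiffAt ℝ ∞ (fun q : E × ℝ => iteratedDeriv n (f q.1) q.2) q := by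
  induction n generalizing f with
  | zero => simpa using hf
  | succ n ih =>
    simp only [iteratedDeriv_succ']
    exact ih (f := fun p => deriv (f p)) (contDiffAt_param_deriv hf)

lemma contDiffAt_param_schwarzian {f : E → ℝ → ℂ} {q : E × ℝ}
    (hf : ContDiffAt ℝ ∞ (fun q : E × ℝ => f q.1 q.2) q) (h : deriv (f q.1) q.2 ≠ 0) :
    ContDiffAt ℝ ∞ (fun q : E × ℝ => schwarzian (f q.1) q.2) q := by
  have h1 := contDiffAt_param_deriv hf
  have h2 := contDiffAt_param_iteratedDeriv 2 hf
  have h3 := contDiffAt_param_iteratedDeriv 3 hf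
  exact (contDiffAt_complex_div h3 h1 h).sub (contDiffAt_const.mul ((contDiffAt_complex_div h2 h1 h).pow 2))

/-- This perturbation adjusts one derivative of a curve at x without disturbing the lower ones. -/
lemma iteratedDeriv_add_monomial {f : ℝ → ℂ} {x : ℝ} (hf : ContDiffAt ℝ ∞ f x) (b : ℂ) (i n : ℕ) :
    iteratedDeriv i (fun t => f t + ((t - x) ^ n) • b) x =
      iteratedDeriv i f x + (if i = n then (n.factorial : ℝ) else 0) • b := by
  have hle : (i : WithTop ℕ∞) ≤ ∞ := by exact_mod_cast le_top
  have hp : ContDiffAt ℝ i (fun t : ℝ => (t - x) ^ n) x := by fun_prop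
  have hpb : ContDiffAt ℝ i (fun t : ℝ => (t - x) ^ n • b) x := hp.smul contDiffAt_const
  rw [iteratedDeriv_fun_add (hf.of_le hle) hpb, iteratedDeriv_smul_const hp,
    iteratedDeriv_comp_sub_const i (fun s : ℝ => s ^ n) x]
  simp only [sub_self]
  rw [iteratedDeriv_fun_pow_zero]
  split_ifs <;> simp

/-- Curves with normalized 2-jet at `ξ p` and prescribed derivatives of the Schwarzian, depending
smoothly on the parameter `p`. -/
theorem exists_normalized_family (ξ : E → ℝ) (hξ : ContDiff ℝ ∞ ξ) (s : ℕ → E → ℂ)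
    (hs : ∀ j, ContDiff ℝ ∞ (s j)) (n : ℕ) :
    ∃ M : E → ℝ → ℂ, ContDiff ℝ ∞ (fun q : E × ℝ => M q.1 q.2) ∧
      ∀ p, M p (ξ p) = 0 ∧ deriv (M p) (ξ p) = 1 ∧
        ∀ j < n, iteratedDeriv j (schwarzian (M p)) (ξ p) = s j p := by
  induction n with
  | zero =>
    refine ⟨fun p t => ((t - ξ p : ℝ) : ℂ), ?_, fun p => ⟨by simp, ?_, by simp⟩⟩
    · exact Complex.ofRealCLM.contDiff.comp (contDiff_snd.sub (hξ.comp contDiff_fst))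
    · exact (((hasDerivAt_id (ξ p)).sub_const (ξ p)).ofReal_comp).deriv
  | succ n ih =>
    obtain ⟨M, hM, h⟩ := ih
    have hMp : ∀ p, ContDiff ℝ ∞ (M p) := fun p =>
      hM.comp (contDiff_const.prodMk contDiff_id : ContDiff ℝ ∞ fun t : ℝ => ((p, t) : E × ℝ))
    have h1 : ∀ p, deriv (M p) (ξ p) ≠ 0 := fun p => by rw [(h p).2.1]; exact one_ne_zero
    -- Adding b(t - ξ)ⁿ⁺³ changes the derivative of order n + 3 by (n + 3)!·b. As the first
    -- derivative is 1, the n-th derivative of the Schwarzian changes by the same amount, and this b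
    -- makes it equal to `s n p`.
    set b : E → ℂ := fun p => ((n + 3).factorial : ℝ)⁻¹ •
      (s n p - iteratedDeriv n (schwarzian (M p)) (ξ p)) with hb
    have hbs : ContDiff ℝ ∞ b := by
      refine contDiff_iff_contDiffAt.2 fun p => ?_
      refine ContDiffAt.const_smul _ ((hs n).contDiffAt.sub ?_)
      have := contDiffAt_param_iteratedDeriv n (f := fun p => schwarzian (M p)) (q := (p, ξ p))
        (contDiffAt_param_schwarzian hM.contDiffAt (h1 p))
      exact ContDiffAt.comp p (g := fun q : E × ℝ => iteratedDeriv n (schwarzian (M q.1)) q.2)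
        (f := fun p => (p, ξ p)) this (contDiffAt_id.prodMk hξ.contDiffAt)
    have hM' : ContDiff ℝ ∞ (fun q : E × ℝ => M q.1 q.2 + ((q.2 - ξ q.1) ^ (n + 3)) • b q.1) :=
      hM.add (((contDiff_snd.sub (hξ.comp contDiff_fst)).pow (n + 3)).smul (hbs.comp contDiff_fst))
    have hM'p : ∀ p, ContDiff ℝ ∞ (fun t => M p t + ((t - ξ p) ^ (n + 3)) • b p) := fun p =>
      hM'.comp (contDiff_const.prodMk contDiff_id : ContDiff ℝ ∞ fun t : ℝ => ((p, t) : E × ℝ))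
    have jets := fun p i => iteratedDeriv_add_monomial (hMp p).contDiffAt (x := ξ p) (b p) i (n + 3)
    have low : ∀ p, ∀ i < n + 3, iteratedDeriv i (fun t => M p t + ((t - ξ p) ^ (n + 3)) • b p)
        (ξ p) = iteratedDeriv i (M p) (ξ p) := fun p i hi => by
      rw [jets, if_neg (by omega)]; simp
    have hd : ∀ p, deriv (fun t => M p t + ((t - ξ p) ^ (n + 3)) • b p) (ξ p) = 1 := fun p => by
      have := low p 1 (by omega)
      rw [iteratedDeriv_one, iteratedDeriv_one] at this
      rw [this, (h p).2.1]
    refine ⟨fun p t => M p t + ((t - ξ p) ^ (n + 3)) • b p, hM', fun p => ⟨?_, hd p, ?_⟩⟩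
    · simp [(h p).1]
    · intro j hj
      have key := iteratedDeriv_schwarzian_sub j (hM'p p).contDiffAt (hMp p).contDiffAt (x := ξ p)
        (by rw [hd]; exact one_ne_zero) (fun i hi => low p i (by omega))
      rw [hd, div_one, jets, add_sub_cancel_left] at key
      rcases (by omega : j < n ∨ j = n) with hj | rfl
      · rw [if_neg (by omega), zero_smul, sub_eq_zero] at key
        rw [key, (h p).2.2 j hj]
      · rw [if_pos rfl, hb, smul_smul, mul_inv_cancel₀ (by positivity), one_smul] at key
        exact sub_left_injective key

end Parameters

/-! ### Curvatures and the Schwarzian -/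

/-- The plane as the complex line. -/
noncomputable def toComplex : Plane ≃L[ℝ] ℂ :=
  ({ toFun := fun p => ⟨p 0, p 1⟩
     map_add' := fun _ _ => rfl
     map_smul' := fun c p => by apply Complex.ext <;> simp
     invFun := fun z => ![z.re, z.im]
     left_inv := fun p => by ext i; fin_cases i <;> simp
     right_inv := fun z => by simp } : Plane ≃ₗ[ℝ] ℂ).toContinuousLinearEquiv

lemma toComplex_apply (p : Plane) : toComplex p = ⟨p 0, p 1⟩ := rfl

/-- For complex p, q one has q/p = (p·q + i det(p q))/‖p‖². Apply this to z'''/z' and z''/z', and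
square the latter. -/
lemma schwarzian_toComplex (m : ℝ → Plane) (x : ℝ) :
    schwarzian (fun t => toComplex (m t)) x = toComplex ![-kappa1 m x, kappa2 m x] := by
  have e1 : deriv (fun t => toComplex (m t)) x = toComplex (deriv m x) := by
    simpa only [iteratedDeriv_one] using iteratedDeriv_clm toComplex 1 m x
  have hN : Complex.normSq ⟨deriv m x 0, deriv m x 1⟩ = norm2 (deriv m x) ^ 2 := by
    rw [norm2_sq, dot_self, Complex.normSq_mk]
  have h4 : norm2 (deriv m x) ^ 4 = (norm2 (deriv m x) ^ 2) ^ 2 := by ring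
  simp only [schwarzian, e1, iteratedDeriv_clm]
  simp only [toComplex_apply, kappa1, kappa2, h4, det2, dot_eq]
  apply Complex.ext
  · simp only [Complex.sub_re, sq (_ / _ : ℂ), Complex.mul_re,
      Complex.div_re, Complex.div_im, hN]
    simp
    ring
  · simp only [Complex.sub_im, sq (_ / _ : ℂ), Complex.mul_im,
      Complex.div_re, Complex.div_im, hN]
    simp
    ring

section Curve

variable {m m₁ m₂ : ℝ → Plane} {x : ℝ}

lemma deriv_toComplex : deriv (fun t => toComplex (m t)) x = toComplex (deriv m x) := by
  simpa only [iteratedDeriv_one] using iteratedDeriv_clm toComplex 1 m x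

lemma contDiffAt_toComplex {n : WithTop ℕ∞} (hm : ContDiffAt ℝ n m x) :
    ContDiffAt ℝ n (fun t => toComplex (m t)) x :=
  toComplex.contDiff.contDiffAt.comp x hm

lemma deriv_toComplex_ne_zero (h : deriv m x ≠ 0) :
    deriv (fun t => toComplex (m t)) x ≠ 0 := by
  rw [deriv_toComplex]; simpa using h

lemma iteratedDeriv_plane_apply {n : ℕ} (hm : ContDiffAt ℝ n m x) (i : Fin 2) :
    iteratedDeriv n m x i = iteratedDeriv n (fun t => m t i) x := by
  have := (ContinuousLinearMap.proj (R := ℝ) (φ := fun _ : Fin 2 => ℝ) i).iteratedFDeriv_comp_left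
    hm le_rfl
  rw [iteratedDeriv_eq_iteratedFDeriv, iteratedDeriv_eq_iteratedFDeriv]
  exact (congrArg (fun v => v fun _ => (1 : ℝ)) this).symm

lemma iteratedDeriv_schwarzian_toComplex (n : ℕ) (hm : ContDiffAt ℝ ∞ m x) (h : deriv m x ≠ 0) :
    iteratedDeriv n (schwarzian fun t => toComplex (m t)) x =
      ⟨-iteratedDeriv n (kappa1 m) x, iteratedDeriv n (kappa2 m) x⟩ := by
  have hle : (n : WithTop ℕ∞) ≤ ∞ := by exact_mod_cast le_top
  have hS := contDiffAt_schwarzian (contDiffAt_toComplex hm) (deriv_toComplex_ne_zero h)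
  have e : (schwarzian fun t => toComplex (m t)) =
      fun t => toComplex ![-kappa1 m t, kappa2 m t] := funext (schwarzian_toComplex m)
  have hk : ContDiffAt ℝ n (fun t => (![-kappa1 m t, kappa2 m t] : Plane)) x := by
    rw [e] at hS
    have := (toComplex.symm.contDiff.contDiffAt (n := ∞)).comp x hS
    refine (this.of_le hle).congr_of_eventuallyEq (Eventually.of_forall fun t => ?_)
    simp
  rw [e, iteratedDeriv_clm, toComplex_apply, iteratedDeriv_plane_apply hk,
    iteratedDeriv_plane_apply hk]
  simp [iteratedDeriv_fun_neg]

/-! ### Transitivity -/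

/-- The difference u - v is a multiple of `lift p`, whose last coordinate is 1; equal last
coordinates force the multiple to be 0. -/
lemma eq_of_mulVec_sub {A : Matrix (Fin 4) (Fin 4) ℝ} (hA : IsUnit A.det) {p : Plane} {l r : ℝ}
    (hl : l ≠ 0) (hp : A *ᵥ lift p = ![0, 0, 0, l]) {u v u' v' : Fin 4 → ℝ}
    (hu : A *ᵥ u = u') (hv : A *ᵥ v = v') (h3 : u 3 = v 3) (h : u' - v' = ![0, 0, 0, r]) :
    u = v := by
  have e : A *ᵥ (u - v) = A *ᵥ ((r / l) • lift p) := by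
    rw [Matrix.mulVec_sub, hu, hv, h, Matrix.mulVec_smul, hp]
    ext i; fin_cases i <;> simp [hl]
  have e' := Matrix.mulVec_injective_of_isUnit ((Matrix.isUnit_iff_isUnit_det A).2 hA) e
  have h0 : r / l = 0 := by
    have := congrFun e' 3
    simpa [h3, lift, eq_comm] using this
  rw [h0, zero_smul] at e'
  exact sub_eq_zero.1 e'

/-- The frame determines the 2-jet. -/
lemma jet_two_eq_of_rhoM_eq (h₁ : deriv m₁ x ≠ 0) (h₂ : deriv m₂ x ≠ 0)
    (h : rhoM m₁ x = rhoM m₂ x) : ∀ i < 3, iteratedDeriv i m₁ x = iteratedDeriv i m₂ x := by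
  have hu := (isLorentz_rhoM h₁).isUnit_det
  have l₁ := (norm2_pos h₁).ne'
  have a0 := rhoM_mulVec_lift (m := m₁) (x := x)
  have a1 := rhoM_mulVec_deriv h₁
  obtain ⟨c, a2⟩ := rhoM_mulVec_deriv_two h₁
  have b0 := rhoM_mulVec_lift (m := m₂) (x := x)
  have b1 := rhoM_mulVec_deriv h₂
  obtain ⟨c', b2⟩ := rhoM_mulVec_deriv_two h₂
  rw [← h] at b0 b1 b2
  -- Position, first and second derivative are recovered in turn. Each step identifies the quantity
  -- (`norm2`, then `frameEta` at 0) that makes the next pair of images differ only in the last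
  -- coordinate.
  have k0 : lift (m₁ x) = lift (m₂ x) := by
    refine eq_of_mulVec_sub (r := norm2 (deriv m₁ x) - norm2 (deriv m₂ x)) hu l₁ a0 a0 b0 (by simp [lift]) ?_
    ext i; fin_cases i <;> simp
  have hm : m₁ x = m₂ x := by
    ext i
    fin_cases i
    · simpa [lift] using congrFun k0 1
    · simpa [lift] using congrFun k0 2
  have hn : norm2 (deriv m₁ x) = norm2 (deriv m₂ x) := by
    rw [← k0, a0] at b0
    simpa using congrFun b0 3
  have k1 := eq_of_mulVec_sub (r := norm2 (deriv m₁ x) * frameEta m₁ x 0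
      - norm2 (deriv m₁ x) * frameEta m₂ x 0) hu l₁ a0 a1 b1 (by simp)
      (by rw [← hn]; ext i; fin_cases i <;> simp)
  have hd : deriv m₁ x = deriv m₂ x := by
    ext i
    fin_cases i
    · simpa [-Matrix.vec2_dotProduct] using congrFun k1 1
    · simpa [-Matrix.vec2_dotProduct] using congrFun k1 2
  have hη : frameEta m₁ x 0 = frameEta m₂ x 0 := by
    rw [← k1, a1, ← hn] at b1
    simpa [l₁] using congrFun b1 3
  have k2 := eq_of_mulVec_sub (r := c - c') hu l₁ a0 a2 b2 (by simp)
      (by rw [← hn, hη]; ext i; fin_cases i <;> simp)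
  have hdd : iteratedDeriv 2 m₁ x = iteratedDeriv 2 m₂ x := by
    ext i
    fin_cases i
    · simpa [-Matrix.vec2_dotProduct] using congrFun k2 1
    · simpa [-Matrix.vec2_dotProduct] using congrFun k2 2
  intro i hi
  interval_cases i
  · simpa using hm
  · simpa using hd
  · exact hdd

/-- The element of the group which takes the frame of `m₁` to the frame of `m₂`. -/
lemma denom_transport (h₁ : deriv m₁ x ≠ 0) (h₂ : deriv m₂ x ≠ 0) :
    0 < denom ((rhoM m₂ x)⁻¹ * rhoM m₁ x) (m₁ x) := by
  have hu := (isLorentz_rhoM h₂).isUnit_det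
  have l₁ := norm2_pos h₁
  have l₂ := norm2_pos h₂
  have e : ((rhoM m₂ x)⁻¹ * rhoM m₁ x) *ᵥ lift (m₁ x) =
      (norm2 (deriv m₁ x) / norm2 (deriv m₂ x)) • lift (m₂ x) := by
    have : (![0, 0, 0, norm2 (deriv m₁ x)] : Fin 4 → ℝ) =
        (norm2 (deriv m₁ x) / norm2 (deriv m₂ x)) • (rhoM m₂ x *ᵥ lift (m₂ x)) := by
      rw [rhoM_mulVec_lift]
      ext i; fin_cases i <;> simp
      field_simp
    rw [← Matrix.mulVec_mulVec, rhoM_mulVec_lift, this, Matrix.mulVec_smul, Matrix.mulVec_mulVec,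
      Matrix.nonsing_inv_mul _ hu, Matrix.one_mulVec]
  rw [denom, e]
  simp [lift]
  positivity

lemma isLorentz_transport (h₁ : deriv m₁ x ≠ 0) (h₂ : deriv m₂ x ≠ 0) :
    IsLorentz ((rhoM m₂ x)⁻¹ * rhoM m₁ x) :=
  (isLorentz_rhoM h₂).inv.mul (isLorentz_rhoM h₁)

lemma det_transport (h₁ : deriv m₁ x ≠ 0) (h₂ : deriv m₂ x ≠ 0) :
    ((rhoM m₂ x)⁻¹ * rhoM m₁ x).det = 1 := by
  rw [Matrix.det_mul, det_inv_eq_one (det_rhoM h₂), det_rhoM h₁, one_mul]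

/-- Curves with the same curvatures are congruent. -/
theorem jet_transport {k : ℕ} (hm₁ : ContDiffAt ℝ ∞ m₁ x) (hm₂ : ContDiffAt ℝ ∞ m₂ x)
    (h₁ : deriv m₁ x ≠ 0) (h₂ : deriv m₂ x ≠ 0) (hk : kappaJet k m₁ x = kappaJet k m₂ x) :
    jet k (fun t => act ((rhoM m₂ x)⁻¹ * rhoM m₁ x) (m₁ t)) x = jet k m₂ x := by
  have hL := isLorentz_transport h₁ h₂
  have hdet := det_transport h₁ h₂
  have hd := denom_transport h₁ h₂
  -- By equivariance the left side is the frame of the transported curve.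
  have hr : (rhoM m₁ x) * ((rhoM m₂ x)⁻¹ * rhoM m₁ x)⁻¹ = rhoM m₂ x := by
    rw [Matrix.mul_inv_rev, Matrix.nonsing_inv_nonsing_inv _ (isLorentz_rhoM h₂).isUnit_det,
      ← Matrix.mul_assoc, Matrix.mul_nonsing_inv _ (isLorentz_rhoM h₁).isUnit_det, Matrix.one_mul]
  generalize (rhoM m₂ x)⁻¹ * rhoM m₁ x = Θ at *
  have hle : ∀ k : ℕ, (k : WithTop ℕ∞) ≤ ∞ := fun k => by exact_mod_cast le_top
  have hm₁' := contDiffAt_act_comp hm₁ hd.ne'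
  have h₁' := deriv_act_ne_zero (hm₁.of_le (hle 2)) h₁ hL hd.ne'
  have hj := jet_two_eq_of_rhoM_eq h₁' h₂
    ((rhoM_act (hm₁.of_le (hle 2)) h₁ hL hdet hd).trans hr)
  -- This covers all orders below (k - 2) + 3, which is at least k + 1 even when the subtraction
  -- truncates.
  have key := iteratedDeriv_eq_of_schwarzian (k - 2) (contDiffAt_toComplex hm₁')
    (contDiffAt_toComplex hm₂) (deriv_toComplex_ne_zero h₁')
    (fun i hi => by rw [iteratedDeriv_clm, iteratedDeriv_clm, hj i hi])
    (fun i hi => by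
      rw [iteratedDeriv_schwarzian_toComplex i hm₁' h₁', iteratedDeriv_schwarzian_toComplex i hm₂ h₂]
      have e := iteratedDeriv_kappa_act i (hm₁.of_le (hle _)) h₁ hL hd.ne'
      have e1 := congrFun (congrFun hk ⟨i, hi⟩) 0
      have e2 := congrFun (congrFun hk ⟨i, hi⟩) 1
      simp [kappaJet] at e1 e2
      rw [e.1, e.2, hdet, one_mul, e1, e2])
  funext i
  have := key i (by have := i.2; omega)
  rw [iteratedDeriv_clm, iteratedDeriv_clm] at this
  exact toComplex.injective this

lemma kappaJet_act {k : ℕ} {Θ : Matrix (Fin 4) (Fin 4) ℝ} (hm : ContDiffAt ℝ ∞ m x)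
    (h : deriv m x ≠ 0) (hΘ : IsLorentz Θ) (hdet : Θ.det = 1) (hd : denom Θ (m x) ≠ 0) :
    kappaJet k (fun t => act Θ (m t)) x = kappaJet k m x := by
  funext j
  have hle : ∀ k : ℕ, (k : WithTop ℕ∞) ≤ ∞ := fun k => by exact_mod_cast le_top
  have e := iteratedDeriv_kappa_act j (hm.of_le (hle _)) h hΘ hd
  rw [hdet, one_mul] at e
  simp only [kappaJet, e.1, e.2]

lemma invariant_eq {k : ℕ} {U : Set (ℝ × JetFibre k)} {I : ℝ × JetFibre k → ℝ}
    (hI : IsDifferentialInvariantOn k U I) (hm₁ : ContDiffAt ℝ ∞ m₁ x) (hm₂ : ContDiffAt ℝ ∞ m₂ x)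
    (h₁ : deriv m₁ x ≠ 0) (h₂ : deriv m₂ x ≠ 0) (hU₁ : (x, jet k m₁ x) ∈ U)
    (hU₂ : (x, jet k m₂ x) ∈ U) (hk : kappaJet k m₁ x = kappaJet k m₂ x) :
    I (x, jet k m₁ x) = I (x, jet k m₂ x) := by
  have e := jet_transport hm₁ hm₂ h₁ h₂ hk
  rw [← e]
  refine (hI _ (isLorentz_transport h₁ h₂) (det_transport h₁ h₂) m₁ x hm₁
    (denom_transport h₁ h₂).ne' hU₁ ?_).symm
  rwa [e]

/-- A regular jet is the jet of a regular curve (a condition only for `k = 0`). -/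
lemma exists_regular {k : ℕ} (hm : ContDiffAt ℝ ∞ m x) (h : (jet k m x).IsRegular) :
    ∃ m' : ℝ → Plane, ContDiffAt ℝ ∞ m' x ∧ deriv m' x ≠ 0 ∧ jet k m' x = jet k m x ∧
      kappaJet k m' x = kappaJet k m x := by
  rcases Nat.eq_zero_or_pos k with rfl | hk
  -- A 0-jet records only the position, so any line through it with nonzero velocity will do.
  · refine ⟨fun t => m x + (t - x) • (fun _ => 1), by fun_prop, ?_, ?_, ?_⟩
    · have : HasDerivAt (fun t : ℝ => m x + (t - x) • (fun _ => 1 : Plane)) (fun _ => 1) x := by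
        simpa using (((hasDerivAt_id x).sub_const x).smul_const (fun _ => 1 : Plane)).const_add (m x)
      rw [this.deriv]
      intro h0
      exact one_ne_zero (congrFun h0 0)
    · funext i
      simp [jet]
    · funext i
      exact i.elim0
  · refine ⟨m, hm, ?_, rfl, rfl⟩
    have := h ⟨1, by omega⟩ rfl
    simpa [jet] using this

end Curve

/-! ### Generation of the differential invariants -/

/-- A smooth family of curves which pass through the origin at `p.1` with curvatures `p.2`. -/
lemma exists_curve_family (k : ℕ) :
    ∃ N : ℝ × (Fin (k - 2) → Fin 2 → ℝ) → ℝ → Plane,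
      ContDiff ℝ ∞ (fun q : (ℝ × (Fin (k - 2) → Fin 2 → ℝ)) × ℝ => N q.1 q.2) ∧
        ∀ p, N p p.1 = 0 ∧ deriv (N p) p.1 ≠ 0 ∧ kappaJet k (N p) p.1 = p.2 := by
  obtain ⟨M, hM, h⟩ := exists_normalized_family
    (Prod.fst : ℝ × (Fin (k - 2) → Fin 2 → ℝ) → ℝ) contDiff_fst
    -- The prescribed Schwarzian data are -κ₁ + iκ₂, with the default 0 beyond the available
    -- indices.
    (fun j p => if hj : j < k - 2 then toComplex ![-p.2 ⟨j, hj⟩ 0, p.2 ⟨j, hj⟩ 1] else 0)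
    (fun j => by
      by_cases hj : j < k - 2
      · simp only [dif_pos hj]
        refine toComplex.contDiff.comp (contDiff_pi.2 fun i => ?_)
        fin_cases i <;> simp <;> fun_prop
      · simp only [dif_neg hj]
        exact contDiff_const) (k - 2)
  have hMp : ∀ p, ContDiff ℝ ∞ (M p) := fun p =>
    hM.comp (contDiff_const.prodMk contDiff_id :
      ContDiff ℝ ∞ fun t : ℝ => ((p, t) : (ℝ × (Fin (k - 2) → Fin 2 → ℝ)) × ℝ))
  have hNp : ∀ p, ContDiff ℝ ∞ (fun t => toComplex.symm (M p t)) := fun p =>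
    toComplex.symm.contDiff.comp (hMp p)
  have hd : ∀ p, deriv (fun t => toComplex.symm (M p t)) p.1 ≠ 0 := fun p h0 => by
    have := deriv_toComplex (m := fun t => toComplex.symm (M p t)) (x := p.1)
    simp only [ContinuousLinearEquiv.apply_symm_apply] at this
    rw [h0, map_zero] at this
    exact one_ne_zero ((h p).2.1.symm.trans this)
  refine ⟨fun p t => toComplex.symm (M p t), toComplex.symm.contDiff.comp hM,
    fun p => ⟨by simp [(h p).1], hd p, ?_⟩⟩
  funext j
  have e := iteratedDeriv_schwarzian_toComplex j (hNp p).contDiffAt (hd p)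
  simp only [ContinuousLinearEquiv.apply_symm_apply] at e
  have e' := (h p).2.2 j j.2
  rw [dif_pos j.2, toComplex_apply] at e'
  have e2 := e.symm.trans e'
  have r := congrArg Complex.re e2
  have i := congrArg Complex.im e2
  simp at r i
  ext l
  fin_cases l
  · simpa [kappaJet] using r
  · simpa [kappaJet] using i

/-- A smooth section of the curvatures through a given regular jet. -/
lemma exists_section {k : ℕ} {m : ℝ → Plane} {x : ℝ} (hm : ContDiffAt ℝ ∞ m x)
    (h : deriv m x ≠ 0) :
    ∃ c : ℝ × (Fin (k - 2) → Fin 2 → ℝ) → ℝ → Plane,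
      (∀ p, ContDiffAt ℝ ∞ (c p) p.1 ∧ kappaJet k (c p) p.1 = p.2) ∧
      jet k (c (x, kappaJet k m x)) x = jet k m x ∧ ContDiff ℝ ∞ (fun p => jet k (c p) p.1) := by
  obtain ⟨N, hN, hp⟩ := exists_curve_family k
  have hNp : ∀ p, ContDiff ℝ ∞ (N p) := fun p =>
    hN.comp (contDiff_const.prodMk contDiff_id :
      ContDiff ℝ ∞ fun t : ℝ => ((p, t) : (ℝ × (Fin (k - 2) → Fin 2 → ℝ)) × ℝ))
  set w := (x, kappaJet k m x) with hw
  set Θ := (rhoM m x)⁻¹ * rhoM (N w) x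
  have hΘ : IsLorentz Θ := isLorentz_transport (hp w).2.1 h
  have hdet : Θ.det = 1 := det_transport (hp w).2.1 h
  -- All curves of the family pass through the origin at their base point, so one nonvanishing
  -- denominator serves every p.
  have hd : ∀ p, denom Θ (N p p.1) ≠ 0 := fun p => by
    rw [(hp p).1, ← (hp w).1]
    exact (denom_transport (hp w).2.1 h).ne'
  refine ⟨fun p t => act Θ (N p t), fun p => ⟨contDiffAt_act_comp (hNp p).contDiffAt (hd p), ?_⟩,
    jet_transport (hNp w).contDiffAt hm (hp w).2.1 h (hp w).2.2, ?_⟩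
  · rw [kappaJet_act (hNp p).contDiffAt (hp p).2.1 hΘ hdet (hd p), (hp p).2.2]
  · refine contDiff_iff_contDiffAt.2 fun p => contDiffAt_pi.2 fun i => ?_
    have hq : ContDiffAt ℝ ∞ (fun q : (ℝ × (Fin (k - 2) → Fin 2 → ℝ)) × ℝ => act Θ (N q.1 q.2))
        (p, p.1) :=
      ContDiffAt.comp (p, p.1) (g := act Θ) (contDiffAt_act (hd p)) hN.contDiffAt
    have hf : ContDiffAt ℝ ∞ (fun p : ℝ × (Fin (k - 2) → Fin 2 → ℝ) => (p, p.1)) p :=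
      contDiffAt_id.prodMk contDiffAt_fst
    have hg := contDiffAt_param_iteratedDeriv (i : ℕ) (f := fun p t => act Θ (N p t)) hq
    have hc := ContDiffAt.comp (f := fun p : ℝ × (Fin (k - 2) → Fin 2 → ℝ) => (p, p.1)) p hg hf
    simpa only [Function.comp_def, jet] using hc

/-- The curvatures generate the differential invariants. -/
theorem generation (k : ℕ) (U : Set (ℝ × JetFibre k)) (I : ℝ × JetFibre k → ℝ) (hU : IsOpen U)
    (hreg : ∀ p ∈ U, p.2.IsRegular) (hI : IsDifferentialInvariantOn k U I) :
    IsOpen (kappaImage k U) ∧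
      ∃ F : ℝ × (Fin (k - 2) → Fin 2 → ℝ) → ℝ,
        (∀ (m : ℝ → Plane) (x : ℝ), ContDiffAt ℝ ∞ m x → (x, jet k m x) ∈ U →
          I (x, jet k m x) = F (x, kappaJet k m x)) ∧
        ∀ r : ℕ∞, ContDiffOn ℝ r I U → ContDiffOn ℝ r F (kappaImage k U) := by
  classical
  have hsec : ∀ w ∈ kappaImage k U, ∃ c : ℝ × (Fin (k - 2) → Fin 2 → ℝ) → ℝ → Plane,
      (∀ p, ContDiffAt ℝ ∞ (c p) p.1 ∧ kappaJet k (c p) p.1 = p.2) ∧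
      (w.1, jet k (c w) w.1) ∈ U ∧ ContDiff ℝ ∞ (fun p => jet k (c p) p.1) := by
    rintro w ⟨m, x, hm, hmU, rfl⟩
    obtain ⟨m', hm', h', hj, hκ⟩ := exists_regular hm (hreg _ hmU)
    obtain ⟨c, h1, h2, h3⟩ := exists_section (k := k) hm' h'
    rw [hκ, hj] at h2
    exact ⟨c, h1, by simpa only [h2] using hmU, h3⟩
  have hnhds : ∀ {w : ℝ × (Fin (k - 2) → Fin 2 → ℝ)}
      {c : ℝ × (Fin (k - 2) → Fin 2 → ℝ) → ℝ → Plane},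
      ContDiff ℝ ∞ (fun p => jet k (c p) p.1) → (w.1, jet k (c w) w.1) ∈ U →
      ∀ᶠ p in 𝓝 w, (p.1, jet k (c p) p.1) ∈ U := fun {w c} h3 h2 =>
    (continuous_fst.prodMk h3.continuous).continuousAt.eventually (hU.mem_nhds h2)
  refine ⟨isOpen_iff_eventually.2 fun w hw => ?_, ?_⟩
  · obtain ⟨c, h1, h2, h3⟩ := hsec w hw
    filter_upwards [hnhds h3 h2] with p hp
    exact ⟨c p, p.1, (h1 p).1, hp, by rw [(h1 p).2]⟩
  -- F(w) is the common value of I on the jets in U with curvature data w; off the image the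
  -- condition is vacuous.
  have hex : ∀ w : ℝ × (Fin (k - 2) → Fin 2 → ℝ), ∃ y : ℝ, ∀ (m : ℝ → Plane) (x : ℝ),
      ContDiffAt ℝ ∞ m x → (x, jet k m x) ∈ U → w = (x, kappaJet k m x) →
        I (x, jet k m x) = y := by
    intro w
    by_cases hw : w ∈ kappaImage k U
    · obtain ⟨m₀, x₀, hm₀, hU₀, rfl⟩ := hw
      refine ⟨I (x₀, jet k m₀ x₀), fun m x hm hmU e => ?_⟩
      obtain ⟨rfl, e2⟩ := Prod.mk.inj e
      obtain ⟨m', hm', h', hj, hκ⟩ := exists_regular hm (hreg _ hmU)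
      obtain ⟨m₀', hm₀', h₀', hj₀, hκ₀⟩ := exists_regular hm₀ (hreg _ hU₀)
      rw [← hj, ← hj₀]
      exact invariant_eq hI hm' hm₀' h' h₀' (by rwa [hj]) (by rwa [hj₀]) (by rw [hκ, hκ₀, e2])
    · exact ⟨0, fun m x hm hmU e => absurd ⟨m, x, hm, hmU, e⟩ hw⟩
  choose F hF using hex
  refine ⟨F, fun m x hm hmU => hF _ m x hm hmU rfl, fun r hr w hw => ?_⟩
  obtain ⟨c, h1, h2, h3⟩ := hsec w hw
  have hs : ContDiff ℝ r (fun p : ℝ × (Fin (k - 2) → Fin 2 → ℝ) => (p.1, jet k (c p) p.1)) :=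
    contDiff_fst.prodMk (h3.of_le (by exact_mod_cast le_top))
  -- Near w the function F is I composed with the smooth section, which stays in U because U is
  -- open.
  have hIs : ContDiffAt ℝ r (fun p => I (p.1, jet k (c p) p.1)) w :=
    ContDiffAt.comp w (hr.contDiffAt (hU.mem_nhds h2)) hs.contDiffAt
  refine (hIs.congr_of_eventuallyEq ?_).contDiffWithinAt
  filter_upwards [hnhds h3 h2] with p hp
  exact (hF p (c p) p.1 (h1 p).1 hp (by rw [(h1 p).2])).symm

end Moebius

theorem mainTheorem10 :
    -- the frame: a Lorentz matrix, normalized and right equivariant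
    (∀ (m : ℝ → Moebius.Plane) (x : ℝ), ContDiffAt ℝ 2 m x → deriv m x ≠ 0 →
      Moebius.IsLorentz (Moebius.rhoM m x) ∧ (Moebius.rhoM m x).det = 1 ∧
      Moebius.act (Moebius.rhoM m x) (m x) = 0 ∧
      deriv (fun t => Moebius.act (Moebius.rhoM m x) (m t)) x = ![1, 0] ∧
      iteratedDeriv 2 (fun t => Moebius.act (Moebius.rhoM m x) (m t)) x = 0 ∧
      ∀ Θ : Matrix (Fin 4) (Fin 4) ℝ, Moebius.IsLorentz Θ → Θ.det = 1 →
        0 < Moebius.denom Θ (m x) →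
        Moebius.rhoM (fun t => Moebius.act Θ (m t)) x = Moebius.rhoM m x * Θ⁻¹) ∧
    -- its Maurer-Cartan matrix
    (∀ (m : ℝ → Moebius.Plane) (x : ℝ), ContDiffAt ℝ 3 m x → deriv m x ≠ 0 →
      (∀ i j : Fin 4, DifferentiableAt ℝ (fun t => Moebius.rhoM m t i j) x) ∧
      Moebius.KM m x = Moebius.formKL 1 (Moebius.kappa1 m x) (Moebius.kappa2 m x)) ∧
    -- the entries and their derivatives are differential invariants
    (∀ (m : ℝ → Moebius.Plane) (x : ℝ) (n : ℕ),
      ContDiffAt ℝ ((n + 3 : ℕ) : WithTop ℕ∞) m x → deriv m x ≠ 0 →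
      ∀ Θ : Matrix (Fin 4) (Fin 4) ℝ, Moebius.IsLorentz Θ → Moebius.denom Θ (m x) ≠ 0 →
        deriv (fun t => Moebius.act Θ (m t)) x ≠ 0 ∧
        iteratedDeriv n (Moebius.kappa1 (fun t => Moebius.act Θ (m t))) x
          = iteratedDeriv n (Moebius.kappa1 m) x ∧
        iteratedDeriv n (Moebius.kappa2 (fun t => Moebius.act Θ (m t))) x
          = Θ.det * iteratedDeriv n (Moebius.kappa2 m) x) ∧
    -- they generate all differential invariants
    (∀ (k : ℕ) (U : Set (ℝ × Moebius.JetFibre k)) (I : ℝ × Moebius.JetFibre k → ℝ),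
      IsOpen U → (∀ p ∈ U, p.2.IsRegular) → Moebius.IsDifferentialInvariantOn k U I →
      IsOpen (Moebius.kappaImage k U) ∧
      ∃ F : ℝ × (Fin (k - 2) → Fin 2 → ℝ) → ℝ,
        (∀ (m : ℝ → Moebius.Plane) (x : ℝ), ContDiffAt ℝ ∞ m x → (x, Moebius.jet k m x) ∈ U →
          I (x, Moebius.jet k m x) = F (x, Moebius.kappaJet k m x)) ∧
        ∀ r : ℕ∞, ContDiffOn ℝ r I U → ContDiffOn ℝ r F (Moebius.kappaImage k U)) := by
  refine ⟨fun m x hm h => ⟨Moebius.isLorentz_rhoM h, Moebius.det_rhoM h,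
    (Moebius.hasJet2_act_rhoM hm h).1, (Moebius.hasJet2_act_rhoM hm h).2.deriv_eq,
    (Moebius.hasJet2_act_rhoM hm h).2.iteratedDeriv_two_eq,
    fun Θ hΘ hdet hd => Moebius.rhoM_act hm h hΘ hdet hd⟩,
    fun m x hm h => ⟨fun i j => (Moebius.hasEntryDerivAt_rhoM hm h i j).differentiableAt,
      Moebius.KM_eq hm h⟩,
    fun m x n hm h Θ hΘ hd => ⟨?_, Moebius.iteratedDeriv_kappa_act n hm h hΘ hd⟩,
    Moebius.generation⟩
  exact Moebius.deriv_act_ne_zero (hm.of_le (by exact_mod_cast (by omega : 2 ≤ n + 3))) h hΘ hd
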